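/- Let $\lambda\in\mathbb R$, $M,Q\ge 0$, and consider the Reissner–Nordström–(anti) de Sitter (RNdS) metric \[\mathrm ds^2=-\Delta\,\mathrm dt^2+\frac{\mathrm dr^2}{\Delta}+r^2(\mathrm d\theta^2+\sin^2\theta\,\mathrm d\varphi^2),\qquad \Delta=1-\lambda r^2-\frac{2M}{r}+\frac{Q^2}{r^2},\] extended across its horizons $\Delta=0$ by the ingoing and outgoing Eddington–Finkelstein coordinates, on $\{r\neq0\}$. Let $L\in\mathbb R\setminus\{0\}$, $E>0$, $r_0>0$, $\dot r_0\in\mathbb R$ with $\lambda L^2+E^2\ge 0$. Let $\gamma$ be an equatorial ($\theta=\pi/2$) null geodesic, defined on an open interval (for instance the maximal one), with energy $E=-p_t$ and angular momentum $L=p_\varphi$. Denote by $r=r(\varphi)$ its radius in polar parametrization ($\varphi$ being lifted to a real-valued function along $\gamma$) and suppose that $\varphi=0$ is attained, with $r(0)=r_0$ and $\frac{\mathrm dr}{\mathrm d\varphi}(0)=\dot r_0$. Let $\delta=\lambda+E^2/L^2$, let $\bar r\in\mathbb R$ be any real root of $\delta x^4-x^2+2Mx-Q^2$ with $\bar r\ne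 r_0$, and put \[\gamma_1=4\bar r\delta,\quad \beta=6\bar r^2\delta-1,\quad \alpha=4\bar r^3\delta-2\bar r+2M,\] \[g_2=\tfrac14\Big(\tfrac{\beta^2}{3}-\alpha\gamma_1\Big),\qquad g_3=\tfrac18\Big(\tfrac{\alpha\beta\gamma_1}{6}-\tfrac{\alpha^2\delta}{2}-\tfrac{\beta^3}{27}\Big).\] Assume $g_2^3-27g_3^2\neq0$. Let $\wp=\wp_{g_2,g_3}$ be the Weierstrass function of the lattice $\Lambda\subset\mathbb C$ with invariants $g_2,g_3$, let $z_1,z_2,z_3\in\mathbb C$ be the roots of $4z^3-g_2z-g_3$, and let \[\wp_0=\frac{\alpha}{4(r_0-\bar r)}+\frac{\beta}{12},\qquad z_0=\varepsilon\,R_F(\wp_0-z_1,\wp_0-z_2,\wp_0-z_3),\] \[R_F(x,y,z)=\frac12\int_0^\infty\frac{\mathrm d\zeta}{\sqrt{(\zeta+x)(\zeta+y)(\zeta+z)}},\] where the square root is the principal one and $\varepsilon=1$ if $\alpha\dot r_0\ge0$, $\varepsilon=-1$ if $\alpha\dot r_0<0$. (Equivalently, $z_0=R_F(\ldots)$ with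 the branch of the square root chosen according to the sign of $\alpha\dot r_0$.) Then the integral defining $z_0$ converges absolutely, and for every $\varphi$ in the domain of $r$, \[r(\varphi)=\bar r+\frac{\alpha}{4\wp(z_0+\varphi)-\beta/3},\] where the denominator does not vanish when $z_0+\varphi\notin\Lambda$, and where the formula is read as $r(\varphi)=\bar r$ when $z_0+\varphi\in\Lambda$ (the poles of $\wp$). -/

import Mathlib

open Set MeasureTheory

namespace RNdS

noncomputable section

/-! ## Geodesics in a coordinate patch of `ℝⁿ` -/

/-- The `α`-th coordinate partial derivative of `f` at `x`. -/
def pderiv {n : ℕ} (f : (Fin n → ℝ) → ℝ) (α : Fin n) (x : Fin n → ℝ) : ℝ :=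
  deriv (fun s : ℝ => f (Function.update x α s)) (x α)

/-- The Christoffel symbols `Γ^μ_{αβ} = ½ g^{μν} (g_{νβ,α} + g_{να,β} - g_{αβ,ν})` of the metric
with coefficient matrix `g`. -/
def christoffel {n : ℕ} (g : (Fin n → ℝ) → Matrix (Fin n) (Fin n) ℝ) (μ α β : Fin n)
    (x : Fin n → ℝ) : ℝ :=
  1 / 2 * ∑ ν, (g x)⁻¹ μ ν *
    (pderiv (fun y => g y ν β) α x + pderiv (fun y => g y ν α) β x
      - pderiv (fun y => g y α β) ν x)

/-- The `μ`-th component of the velocity of the coordinate curve `c`. -/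
def velocity {n : ℕ} (c : ℝ → Fin n → ℝ) (μ : Fin n) (l : ℝ) : ℝ :=
  deriv (fun s => c s μ) l

/-- The conjugate momentum `p_μ = g_{μν} ċ^ν` of an uncharged particle. -/
def momentum {n : ℕ} (g : (Fin n → ℝ) → Matrix (Fin n) (Fin n) ℝ) (c : ℝ → Fin n → ℝ)
    (μ : Fin n) (l : ℝ) : ℝ :=
  ∑ ν, g (c l) μ ν * velocity c ν l

/-- `c` is, on the open set `J` of affine parameters, an affinely parametrized geodesic of the
metric `g` on the coordinate domain `U`: it satisfies `c̈^μ + Γ^μ_{αβ} ċ^α ċ^β = 0`. -/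
structure IsGeodesicOn {n : ℕ} (g : (Fin n → ℝ) → Matrix (Fin n) (Fin n) ℝ)
    (U : Set (Fin n → ℝ)) (c : ℝ → Fin n → ℝ) (J : Set ℝ) : Prop where
  mem : ∀ l ∈ J, c l ∈ U
  contDiffOn : ContDiffOn ℝ 2 c J
  geodesic_eq : ∀ l ∈ J, ∀ μ,
    deriv (velocity c μ) l
      + ∑ α, ∑ β, christoffel g μ α β (c l) * velocity c α l * velocity c β l = 0

/-! ## The Reissner–Nordström–(anti) de Sitter spacetime

`lam` is one third of the cosmological constant, `M` the mass and `Q` the charge. -/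

/-- The function `1 - λ r² - 2 M / r + Q² / r²`. -/
def horizonFn (lam M Q r : ℝ) : ℝ := 1 - lam * r ^ 2 - 2 * M / r + Q ^ 2 / r ^ 2

/-- The kinds of coordinate patches used for the (extended) spacetime. The last three coordinates
are always `(r, θ, φ)`. The first one is the Boyer–Lindquist time `t` in the `static` patches, which
avoid the horizons, and `t + ∫ dr / Δ`, resp. `t - ∫ dr / Δ` (with `Δ` the function `horizonFn`) in
the `ingoing`, resp. `outgoing`, (Eddington–Finkelstein) patches, in which the metric is regular
across the horizons. -/
inductive Patch where
  | static
  | ingoing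
  | outgoing

/-- The metric. In a static patch,
`ds² = -Δ dt² + dr² / Δ + r² (dθ² + sin² θ dφ²)`; substituting `t = v ∓ ∫ dr / Δ` one gets
`ds² = -Δ dv² ± 2 dv dr + r² (dθ² + sin² θ dφ²)` in the ingoing and outgoing patches. -/
def metric (lam M Q : ℝ) : Patch → (Fin 4 → ℝ) → Matrix (Fin 4) (Fin 4) ℝ
  | .static, x =>
      !![-horizonFn lam M Q (x 1), 0, 0, 0;
         0, 1 / horizonFn lam M Q (x 1), 0, 0;
         0, 0, x 1 ^ 2, 0;
         0, 0, 0, x 1 ^ 2 * Real.sin (x 2) ^ 2]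
  | .ingoing, x =>
      !![-horizonFn lam M Q (x 1), 1, 0, 0;
         1, 0, 0, 0;
         0, 0, x 1 ^ 2, 0;
         0, 0, 0, x 1 ^ 2 * Real.sin (x 2) ^ 2]
  | .outgoing, x =>
      !![-horizonFn lam M Q (x 1), -1, 0, 0;
         -1, 0, 0, 0;
         0, 0, x 1 ^ 2, 0;
         0, 0, 0, x 1 ^ 2 * Real.sin (x 2) ^ 2]

/-- The coordinate domain of a patch. -/
def domain (lam M Q : ℝ) : Patch → Set (Fin 4 → ℝ)
  | .static => {x | x 1 ≠ 0 ∧ Real.sin (x 2) ≠ 0 ∧ horizonFn lam M Q (x 1) ≠ 0}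
  | .ingoing => {x | x 1 ≠ 0 ∧ Real.sin (x 2) ≠ 0}
  | .outgoing => {x | x 1 ≠ 0 ∧ Real.sin (x 2) ≠ 0}

/-- `r` and `φ` are the radial and (lifted, real valued) azimuthal coordinates of an equatorial null
geodesic with energy `E` and angular momentum `L`, parametrized by the open interval `I`. Since no
single time coordinate covers a curve that crosses horizons, the time coordinate `w` is only given
patchwise: around each parameter, `(w, r, π/2, φ)` is, in some patch, a geodesic with
`g_{μν} ċ^μ ċ^ν = 0`, `E = -p_t` and `L = p_φ`. For a curve that stays in `Δ ≠ 0`, the static patch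
can be used with `J = I`. -/
structure IsEquatorialNullGeodesic (lam M Q E L : ℝ) (I : Set ℝ) (r φ : ℝ → ℝ) : Prop where
  isOpen : IsOpen I
  isPreconnected : IsPreconnected I
  exists_patch : ∀ l₀ ∈ I, ∃ (p : Patch) (w : ℝ → ℝ) (J : Set ℝ),
    IsOpen J ∧ l₀ ∈ J ∧ J ⊆ I ∧
    IsGeodesicOn (metric lam M Q p) (domain lam M Q p)
      (fun l => ![w l, r l, Real.pi / 2, φ l]) J ∧
    ∀ l ∈ J,
      (∑ μ, momentum (metric lam M Q p) (fun l => ![w l, r l, Real.pi / 2, φ l]) μ l *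
        velocity (fun l => ![w l, r l, Real.pi / 2, φ l]) μ l = 0) ∧
      -momentum (metric lam M Q p) (fun l => ![w l, r l, Real.pi / 2, φ l]) 0 l = E ∧
      momentum (metric lam M Q p) (fun l => ![w l, r l, Real.pi / 2, φ l]) 3 l = L

/-! ## Carlson's symmetric elliptic integral of the first kind -/

/-- The integrand `1 / √((ζ + x) (ζ + y) (ζ + z))`, with the principal square root. -/
def carlsonIntegrand (x y z : ℂ) (ζ : ℝ) : ℂ :=
  1 / (((ζ : ℂ) + x) * ((ζ : ℂ) + y) * ((ζ : ℂ) + z)) ^ (1 / 2 : ℂ)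

/-- `R_F(x, y, z) = ½ ∫₀^∞ dζ / √((ζ + x) (ζ + y) (ζ + z))`. -/
def carlsonRF (x y z : ℂ) : ℂ :=
  1 / 2 * ∫ ζ in Ioi (0 : ℝ), carlsonIntegrand x y z ζ

end

end RNdS

/-!
In polar parametrization the geodesic equation becomes `(dr/dφ)² = f(r)` with a quartic `f`, and
the geodesic also solves the equation `r'' = f'(r)/2`, which, unlike the first order one, determines
it across turning points. The Biermann–Weierstrass substitution `r = rbar + (α/4) u` at a root
`rbar` of `f` turns this into the equation solved by `1 / (℘(z₀ + φ) - β/12)` along every horizontal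
line of `ℂ`; passing from `℘` to this reciprocal removes the poles of `℘`, which is where the orbit
goes through `rbar`. Uniqueness then propagates the agreement of value and derivative at `φ = 0` to
the whole orbit.

It remains to see that `℘(z₀) = wp₀` with the correct sign of `℘'(z₀)`. The substitution
`u = 1 / (1 + ζ)` rewrites Carlson's integral as the elliptic integral `∫₀¹ du / √(q u)` of the
quartic `q u = u⁴ p (c + 1 / u)`, where `p` is the Weierstrass cubic and `c = wp₀ - 1`. Such an
integral is inverted by `1 / (℘ - c)`: the failure of the inversion satisfies a linear differential
inequality whose coefficient `1 / |√q|` is unbounded but integrable near the zeros of `q`, which are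
simple, so Grönwall's argument makes it vanish identically.
-/

open Filter Topology

/-- The quartic `u⁴ p (c + 1 / u)` attached to the Weierstrass cubic `p s = 4 s³ - g₂ s - g₃`: the
substitution `s = c + 1 / u` turns `ds / √(p s)` into `-du / √(invQuartic c g₂ g₃ u)`. -/
def invQuartic {A : Type*} [Field A] (c g₂ g₃ u : A) : A :=
  4 * u * (1 + c * u) ^ 3 - g₂ * u ^ 3 * (1 + c * u) - g₃ * u ^ 4

/-- Half of the derivative of `invQuartic`, that is, the right-hand side of the second order
equation obtained by differentiating `u' ^ 2 = invQuartic c g₂ g₃ u`. -/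
def invQuarticHalfDeriv {A : Type*} [Field A] (c g₂ g₃ u : A) : A :=
  2 + 12 * c * u + 3 / 2 * (12 * c ^ 2 - g₂) * u ^ 2 + 2 * (4 * c ^ 3 - g₂ * c - g₃) * u ^ 3

section InvQuartic

lemma invQuartic_zero {A : Type*} [Field A] (c g₂ g₃ : A) : invQuartic c g₂ g₃ 0 = 0 := by
  simp [invQuartic]

lemma invQuartic_eq_pow_mul {A : Type*} [Field A] (c g₂ g₃ : A) {u : A} (hu : u ≠ 0) :
    invQuartic c g₂ g₃ u = u ^ 4 * (4 * (c + 1 / u) ^ 3 - g₂ * (c + 1 / u) - g₃) := by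
  rw [invQuartic]
  field_simp
  ring

lemma invQuarticHalfDeriv_ne_zero {A : Type*} [Field A] [CharZero A] {c g₂ g₃ : A}
    (hdisc : g₂ ^ 3 - 27 * g₃ ^ 2 ≠ 0) {u : A} (hu : invQuartic c g₂ g₃ u = 0) :
    invQuarticHalfDeriv c g₂ g₃ u ≠ 0 := by
  intro h
  have hu0 : u ≠ 0 := by
    rintro rfl
    simp [invQuarticHalfDeriv] at h
  set s := c + 1 / u with hs
  have hroot : 4 * s ^ 3 - g₂ * s - g₃ = 0 :=
    (mul_eq_zero.1 (invQuartic_eq_pow_mul c g₂ g₃ hu0 ▸ hu)).resolve_left (pow_ne_zero 4 hu0)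
  have hdouble : 12 * s ^ 2 - g₂ = 0 := by
    have : u ^ 2 * (12 * s ^ 2 - g₂) =
        4 * u ^ 3 * (4 * s ^ 3 - g₂ * s - g₃) - 2 * invQuarticHalfDeriv c g₂ g₃ u := by
      simp only [hs, invQuarticHalfDeriv]
      field_simp
      ring
    rw [hroot, h, mul_zero, mul_zero, sub_zero] at this
    exact (mul_eq_zero.1 this).resolve_left (pow_ne_zero 2 hu0)
  refine hdisc ?_
  have hg₂ : g₂ = 12 * s ^ 2 := by linear_combination -hdouble
  have hg₃ : g₃ = -8 * s ^ 3 := by linear_combination -hroot - s * hg₂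
  rw [hg₂, hg₃]
  ring

variable {𝕜 : Type*} [NontriviallyNormedField 𝕜] (c g₂ g₃ : 𝕜)

lemma hasDerivAt_invQuartic [CharZero 𝕜] (u : 𝕜) :
    HasDerivAt (invQuartic c g₂ g₃) (2 * invQuarticHalfDeriv c g₂ g₃ u) u := by
  have hid := hasDerivAt_id u
  have hlin : HasDerivAt (fun u : 𝕜 => 1 + c * u) c u := by
    simpa using (hid.const_mul c).const_add 1
  have h := (((hid.const_mul 4).mul (hlin.pow 3)).sub
    (((hid.pow 3).const_mul g₂).mul hlin)).sub ((hid.pow 4).const_mul g₃)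
  refine h.congr_deriv ?_
  simp only [id, invQuarticHalfDeriv, Pi.pow_apply]
  field_simp
  ring

lemma continuous_invQuartic : Continuous (invQuartic c g₂ g₃) := by
  unfold invQuartic
  fun_prop

lemma contDiff_invQuarticHalfDeriv {n : WithTop ℕ∞} :
    ContDiff 𝕜 n (invQuarticHalfDeriv c g₂ g₃) := by
  unfold invQuarticHalfDeriv
  fun_prop

lemma ofReal_invQuarticHalfDeriv (c g₂ g₃ u : ℝ) :
    ((invQuarticHalfDeriv c g₂ g₃ u : ℝ) : ℂ) = invQuarticHalfDeriv (c : ℂ) g₂ g₃ u := by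
  simp [invQuarticHalfDeriv]

end InvQuartic

section InvWeierstrassP

open Classical in
/-- The function `1 / (℘ - c)`, extended by `0` to the poles of `℘`. -/
noncomputable def invWeierstrassP (Λ : PeriodPair) (c z : ℂ) : ℂ :=
  if z ∈ Λ.lattice then 0 else 1 / (Λ.weierstrassP z - c)

/-- The open set on which `invWeierstrassP Λ c` is holomorphic: the complement of the poles of
`1 / (℘ - c)`. -/
def invWeierstrassPDomain (Λ : PeriodPair) (c : ℂ) : Set ℂ :=
  {z | z ∈ Λ.lattice ∨ Λ.weierstrassP z ≠ c}

variable {Λ : PeriodPair} {c z : ℂ}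

lemma invWeierstrassP_of_mem (hz : z ∈ Λ.lattice) : invWeierstrassP Λ c z = 0 := if_pos hz

lemma invWeierstrassP_of_notMem (hz : z ∉ Λ.lattice) :
    invWeierstrassP Λ c z = 1 / (Λ.weierstrassP z - c) := if_neg hz

lemma eventually_notMem_lattice (hz : z ∉ Λ.lattice) : ∀ᶠ w in 𝓝 z, w ∉ Λ.lattice :=
  Λ.isClosed_lattice.isOpen_compl.mem_nhds hz

lemma eventually_nhdsNE_notMem_lattice (Λ : PeriodPair) (z : ℂ) :
    ∀ᶠ w in 𝓝[≠] z, w ∉ Λ.lattice := by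
  filter_upwards [self_mem_nhdsWithin,
    mem_nhdsWithin_of_mem_nhds (Λ.compl_lattice_sdiff_singleton_mem_nhds z)] with w hne hw hl
  exact hw ⟨hl, hne⟩

lemma analyticAt_weierstrassP (hz : z ∉ Λ.lattice) : AnalyticAt ℂ Λ.weierstrassP z :=
  Λ.analyticOnNhd_weierstrassP z hz

lemma tendsto_weierstrassP_cobounded (hz : z ∈ Λ.lattice) :
    Tendsto Λ.weierstrassP (𝓝[≠] z) (Bornology.cobounded ℂ) := by
  rw [tendsto_cobounded_iff_meromorphicOrderAt_neg (Λ.meromorphic_weierstrassP z),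
    Λ.order_weierstrassP z hz]
  decide

lemma eventually_weierstrassP_ne (c : ℂ) (hz : z ∈ Λ.lattice) :
    ∀ᶠ w in 𝓝[≠] z, Λ.weierstrassP w ≠ c :=
  (tendsto_weierstrassP_cobounded hz).eventually
    (show {c}ᶜ ∈ Bornology.cobounded ℂ from Bornology.isBounded_singleton)

lemma not_eventually_weierstrassP_eq (Λ : PeriodPair) (c z : ℂ) :
    ¬ ∀ᶠ w in 𝓝[≠] z, Λ.weierstrassP w = c := by
  have hmero : Meromorphic fun w => Λ.weierstrassP w - c := fun w =>
    (Λ.meromorphic_weierstrassP w).sub (MeromorphicAt.const c w)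
  have h0 : meromorphicOrderAt (fun w => Λ.weierstrassP w - c) 0 ≠ ⊤ := fun h =>
    let ⟨_, hne, heq⟩ := ((eventually_weierstrassP_ne c Λ.lattice.zero_mem).and
      (meromorphicOrderAt_eq_top_iff.1 h)).exists
    hne (sub_eq_zero.1 heq)
  exact fun h => hmero.exists_meromorphicOrderAt_ne_top_iff_forall.1 ⟨0, h0⟩ z
    (meromorphicOrderAt_eq_top_iff.2 (h.mono fun _ => sub_eq_zero.2))

lemma isOpen_invWeierstrassPDomain : IsOpen (invWeierstrassPDomain Λ c) := by
  refine isOpen_iff_mem_nhds.2 fun z hz => ?_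
  by_cases hl : z ∈ Λ.lattice
  · rw [← insert_eq_of_mem hz, insert_mem_nhds_iff]
    exact (eventually_weierstrassP_ne c hl).mono fun _ => Or.inr
  · exact ((analyticAt_weierstrassP hl).continuousAt.eventually_ne (hz.resolve_left hl)).mono
      fun _ => Or.inr

lemma invWeierstrassP_eventuallyEq (hz : z ∉ Λ.lattice) :
    invWeierstrassP Λ c =ᶠ[𝓝 z] fun w => 1 / (Λ.weierstrassP w - c) :=
  (eventually_notMem_lattice hz).mono fun _ => invWeierstrassP_of_notMem

lemma continuousAt_invWeierstrassP_of_mem (c : ℂ) (hz : z ∈ Λ.lattice) :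
    ContinuousAt (invWeierstrassP Λ c) z := by
  rw [continuousAt_iff_punctured_nhds, invWeierstrassP_of_mem hz]
  refine (tendsto_inv₀_cobounded.comp ((tendsto_sub_const_cobounded c).comp
    (tendsto_weierstrassP_cobounded hz))).congr' ?_
  filter_upwards [eventually_nhdsNE_notMem_lattice Λ z] with w hw
  rw [invWeierstrassP_of_notMem hw, one_div]
  rfl

lemma analyticAt_invWeierstrassP_of_notMem (hl : z ∉ Λ.lattice) (hc : Λ.weierstrassP z ≠ c) :
    AnalyticAt ℂ (invWeierstrassP Λ c) z :=
  (analyticAt_const.div ((analyticAt_weierstrassP hl).sub analyticAt_const)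
    (sub_ne_zero.2 hc)).congr (invWeierstrassP_eventuallyEq hl).symm

lemma analyticAt_invWeierstrassP (hz : z ∈ invWeierstrassPDomain Λ c) :
    AnalyticAt ℂ (invWeierstrassP Λ c) z := by
  by_cases hl : z ∈ Λ.lattice
  · refine Complex.analyticAt_of_differentiable_on_punctured_nhds_of_continuousAt ?_
      (continuousAt_invWeierstrassP_of_mem c hl)
    filter_upwards [eventually_nhdsNE_notMem_lattice Λ z, eventually_weierstrassP_ne c hl]
      with w hwl hwc
    exact (analyticAt_invWeierstrassP_of_notMem hwl hwc).differentiableAt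
  · exact analyticAt_invWeierstrassP_of_notMem hl (hz.resolve_left hl)

lemma deriv_invWeierstrassP_of_notMem (hl : z ∉ Λ.lattice) (hc : Λ.weierstrassP z ≠ c) :
    deriv (invWeierstrassP Λ c) z = -Λ.derivWeierstrassP z / (Λ.weierstrassP z - c) ^ 2 := by
  have h := (analyticAt_weierstrassP hl).differentiableAt.hasDerivAt
  rw [Λ.deriv_weierstrassP] at h
  rw [(invWeierstrassP_eventuallyEq hl).deriv_eq]
  simpa only [one_div] using ((h.sub_const c).fun_inv (sub_ne_zero.2 hc)).deriv

lemma deriv_invWeierstrassP_sq (hz : z ∈ invWeierstrassPDomain Λ c) :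
    deriv (invWeierstrassP Λ c) z ^ 2 = invQuartic c Λ.g₂ Λ.g₃ (invWeierstrassP Λ c z) := by
  have off_lattice {w : ℂ} (hl : w ∉ Λ.lattice) (hc : Λ.weierstrassP w ≠ c) :
      deriv (invWeierstrassP Λ c) w ^ 2 = invQuartic c Λ.g₂ Λ.g₃ (invWeierstrassP Λ c w) := by
    have hc' := sub_ne_zero.2 hc
    rw [deriv_invWeierstrassP_of_notMem hl hc, invWeierstrassP_of_notMem hl, div_pow, neg_sq,
      Λ.derivWeierstrassP_sq w hl, invQuartic]
    field_simp
    ring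
  by_cases hl : z ∈ Λ.lattice
  · have hA := analyticAt_invWeierstrassP hz
    refine EventuallyEq.eq_of_nhds (((hA.deriv.continuousAt.pow 2)
      |>.eventuallyEq_nhds_iff_eventuallyEq_nhdsNE ((continuous_invQuartic c Λ.g₂ Λ.g₃).continuousAt
        |>.comp hA.continuousAt)).1 ?_)
    filter_upwards [eventually_nhdsNE_notMem_lattice Λ z, eventually_weierstrassP_ne c hl]
      with w hwl hwc
    exact off_lattice hwl hwc
  · exact off_lattice hl (hz.resolve_left hl)

lemma deriv_invWeierstrassP_of_mem (c : ℂ) (hz : z ∈ Λ.lattice) :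
    deriv (invWeierstrassP Λ c) z = 0 := by
  rw [← sq_eq_zero_iff, deriv_invWeierstrassP_sq (Or.inl hz), invWeierstrassP_of_mem hz,
    invQuartic_zero]

lemma eventually_deriv_invWeierstrassP_ne_zero (hz : z ∈ invWeierstrassPDomain Λ c) :
    ∀ᶠ w in 𝓝[≠] z, deriv (invWeierstrassP Λ c) w ≠ 0 := by
  have hA := analyticAt_invWeierstrassP hz
  refine hA.deriv.eventually_eq_zero_or_eventually_ne_zero.resolve_left fun h => ?_
  have hconst : ∀ᶠ w in 𝓝 z, invWeierstrassP Λ c w - invWeierstrassP Λ c z = 0 := by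
    rw [← analyticOrderAt_eq_top, ← hA.analyticOrderAt_deriv_add_one, analyticOrderAt_eq_top.2 h,
      top_add]
  refine not_eventually_weierstrassP_eq Λ (c + 1 / invWeierstrassP Λ c z) z ?_
  filter_upwards [hconst.filter_mono nhdsWithin_le_nhds, eventually_nhdsNE_notMem_lattice Λ z]
    with w hw hl
  rw [← sub_eq_zero.1 hw, invWeierstrassP_of_notMem hl, one_div_one_div, add_sub_cancel]

lemma deriv_deriv_invWeierstrassP (hz : z ∈ invWeierstrassPDomain Λ c) :
    deriv (deriv (invWeierstrassP Λ c)) z =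
      invQuarticHalfDeriv c Λ.g₂ Λ.g₃ (invWeierstrassP Λ c z) := by
  have hA := analyticAt_invWeierstrassP hz
  have hcont : Continuous (invQuarticHalfDeriv c Λ.g₂ Λ.g₃) :=
    (contDiff_invQuarticHalfDeriv c Λ.g₂ Λ.g₃ (n := 0)).continuous
  refine EventuallyEq.eq_of_nhds ((hA.deriv.deriv.continuousAt
    |>.eventuallyEq_nhds_iff_eventuallyEq_nhdsNE (hcont.continuousAt.comp hA.continuousAt)).1 ?_)
  have hdom : ∀ᶠ w in 𝓝 z, w ∈ invWeierstrassPDomain Λ c := isOpen_invWeierstrassPDomain.mem_nhds hz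
  filter_upwards [eventually_deriv_invWeierstrassP_ne_zero hz,
    hdom.eventually_nhds.filter_mono nhdsWithin_le_nhds] with w hne hw
  have hAw := analyticAt_invWeierstrassP hw.self_of_nhds
  have hleft := hAw.deriv.differentiableAt.hasDerivAt.pow 2
  have hright := (hasDerivAt_invQuartic c Λ.g₂ Λ.g₃ (invWeierstrassP Λ c w)).comp w
    hAw.differentiableAt.hasDerivAt
  have hsq : invQuartic c Λ.g₂ Λ.g₃ ∘ invWeierstrassP Λ c =ᶠ[𝓝 w]
      deriv (invWeierstrassP Λ c) ^ 2 := hw.mono fun v hv => (deriv_invWeierstrassP_sq hv).symm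
  have h := (hleft.congr_of_eventuallyEq hsq).unique hright
  refine mul_left_cancel₀ hne ?_
  simp only [Nat.cast_ofNat, Nat.add_one_sub_one, pow_one] at h
  rw [Function.comp_apply]
  linear_combination h / 2

/-- `1 / (℘ - c)` is unbounded along every filter that tends to one of its poles. -/
lemma mem_invWeierstrassPDomain_of_tendsto {ι : Type*} {f : Filter ι} [f.NeBot] {w : ι → ℂ} {a : ℂ}
    (hw : Tendsto w f (𝓝 z)) (hdom : ∀ i, w i ∈ invWeierstrassPDomain Λ c)
    (ha : Tendsto (fun i => invWeierstrassP Λ c (w i)) f (𝓝 a)) :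
    z ∈ invWeierstrassPDomain Λ c := by
  by_contra hz
  obtain ⟨hl, hc⟩ : z ∉ Λ.lattice ∧ Λ.weierstrassP z = c := by
    simpa [invWeierstrassPDomain] using hz
  have hone : ∀ᶠ i in f, (Λ.weierstrassP (w i) - c) * invWeierstrassP Λ c (w i) = 1 := by
    filter_upwards [hw.eventually (eventually_notMem_lattice hl)] with i hil
    rw [invWeierstrassP_of_notMem hil,
      mul_one_div_cancel (sub_ne_zero.2 ((hdom i).resolve_left hil))]
  have hzero := (((analyticAt_weierstrassP hl).continuousAt.tendsto.comp hw).sub_const c).mul ha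
  rw [hc, sub_self, zero_mul] at hzero
  exact zero_ne_one (tendsto_nhds_unique_of_eventuallyEq hzero tendsto_const_nhds hone)

lemma invWeierstrassP_eq_of_tendsto {ι : Type*} {f : Filter ι} [f.NeBot] {w : ι → ℂ} {a b : ℂ}
    (hw : Tendsto w f (𝓝 z)) (hdom : ∀ i, w i ∈ invWeierstrassPDomain Λ c)
    (ha : Tendsto (fun i => invWeierstrassP Λ c (w i)) f (𝓝 a))
    (hb : Tendsto (fun i => deriv (invWeierstrassP Λ c) (w i)) f (𝓝 b)) :
    z ∈ invWeierstrassPDomain Λ c ∧ invWeierstrassP Λ c z = a ∧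
      deriv (invWeierstrassP Λ c) z = b := by
  have hz := mem_invWeierstrassPDomain_of_tendsto hw hdom ha
  have hA := analyticAt_invWeierstrassP hz
  exact ⟨hz, tendsto_nhds_unique (hA.continuousAt.tendsto.comp hw) ha,
    tendsto_nhds_unique (hA.deriv.continuousAt.tendsto.comp hw) hb⟩

end InvWeierstrassP

section ComplexSqrt

lemma sqrt_ofReal_eq (x : ℝ) : (x : ℂ).sqrt = √x + √(-x) * Complex.I := by
  rw [Complex.sqrt_eq_real_add_ite, Complex.norm_real, Complex.ofReal_re, Complex.ofReal_im,
    if_pos le_rfl, one_mul, Real.norm_eq_abs]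
  rcases le_total 0 x with hx | hx
  · simp [abs_of_nonneg hx, Real.sqrt_eq_zero_of_nonpos (neg_nonpos.2 hx)]
  · rw [abs_of_nonpos hx, neg_add_cancel, show (-x - x) / 2 = -x by ring,
      Real.sqrt_eq_zero_of_nonpos hx]
    simp

lemma sqrt_ofReal_of_nonneg {x : ℝ} (hx : 0 ≤ x) : (x : ℂ).sqrt = √x := by
  simp [sqrt_ofReal_eq, Real.sqrt_eq_zero_of_nonpos (neg_nonpos.2 hx)]

lemma complexSqrt_sq (z : ℂ) : z.sqrt ^ 2 = z := by
  exact_mod_cast Complex.cpow_nat_inv_pow z two_ne_zero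

lemma complexSqrt_eq_zero {z : ℂ} : z.sqrt = 0 ↔ z = 0 := by
  rw [← sq_eq_zero_iff, complexSqrt_sq]

lemma norm_complexSqrt (z : ℂ) : ‖z.sqrt‖ = ‖z‖ ^ (1 / 2 : ℝ) := by
  rw [← Real.sqrt_eq_rpow, eq_comm, Real.sqrt_eq_iff_mul_self_eq (norm_nonneg _) (norm_nonneg _),
    ← sq, ← norm_pow, complexSqrt_sq]

lemma continuous_sqrt_ofReal : Continuous fun x : ℝ => (x : ℂ).sqrt := by
  rw [funext sqrt_ofReal_eq]
  fun_prop

lemma sqrt_ofReal_sq_mul {a : ℝ} (ha : 0 ≤ a) (x : ℝ) :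
    ((a ^ 2 * x : ℝ) : ℂ).sqrt = a * (x : ℂ).sqrt := by
  rw [sqrt_ofReal_eq, sqrt_ofReal_eq, Real.sqrt_mul (sq_nonneg a), ← mul_neg,
    Real.sqrt_mul (sq_nonneg a), Real.sqrt_sq ha]
  push_cast
  ring

lemma hasDerivAt_sqrt_ofReal {x : ℝ} (hx : x ≠ 0) :
    HasDerivAt (fun x : ℝ => (x : ℂ).sqrt) (1 / (2 * (x : ℂ).sqrt)) x := by
  have hpos := (Real.hasDerivAt_sqrt hx).ofReal_comp
  have hneg := ((Real.hasDerivAt_sqrt (neg_ne_zero.2 hx)).comp x (hasDerivAt_neg x)).ofReal_comp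
  rw [funext sqrt_ofReal_eq, sqrt_ofReal_eq]
  refine (hpos.add (hneg.mul_const Complex.I)).congr_deriv ?_
  rcases hx.lt_or_gt with hx | hx
  · have hs : (√(-x) : ℂ) ≠ 0 := Complex.ofReal_ne_zero.2 (Real.sqrt_pos.2 (neg_pos.2 hx)).ne'
    rw [Real.sqrt_eq_zero_of_nonpos hx.le]
    push_cast
    field_simp
    linear_combination -(√(-x) : ℂ) * Complex.I_sq
  · simp [Real.sqrt_eq_zero_of_nonpos (neg_nonpos.2 hx.le)]

end ComplexSqrt

section InverseSqrtOfSimpleZeros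

lemma locallyIntegrable_norm_rpow_neg_half : LocallyIntegrable fun v : ℝ => ‖v‖ ^ (-(1 / 2) : ℝ) :=
  locallyIntegrable_of_norm_le_rpow (C := 1) (α := 1 / 2) (by simp) (by norm_num)
    (Eventually.of_forall fun v => by
      rw [one_mul, Real.norm_eq_abs, abs_of_nonneg (Real.rpow_nonneg (norm_nonneg _) _)])
    (measurable_norm.pow_const _).aestronglyMeasurable

lemma integrableAtFilter_norm_sub_rpow_neg_half (x : ℝ) :
    IntegrableAtFilter (fun v : ℝ => ‖v - x‖ ^ (-(1 / 2) : ℝ)) (𝓝 x) := by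
  have h := ((locallyIntegrable_norm_rpow_neg_half.integrableOn_isCompact
    (isCompact_uIcc (a := -1) (b := 1))).intervalIntegrable).comp_sub_right x
  rw [intervalIntegrable_iff_integrableOn_Ioo_of_le (by linarith)] at h
  exact ⟨_, Ioo_mem_nhds (by linarith) (by linarith), h⟩

variable {k : ℝ → ℝ}

lemma continuousAt_one_div_sqrt {x : ℝ} (hk : ContinuousAt k x) (hx : k x ≠ 0) :
    ContinuousAt (fun v => 1 / (k v : ℂ).sqrt) x :=
  continuousAt_const.div (continuous_sqrt_ofReal.continuousAt.comp hk)
    (complexSqrt_eq_zero.not.2 (Complex.ofReal_ne_zero.2 hx))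

lemma stronglyMeasurable_one_div_sqrt (hk : Measurable k) :
    StronglyMeasurable fun v => 1 / (k v : ℂ).sqrt :=
  ((continuous_sqrt_ofReal.measurable.comp hk).const_div 1).stronglyMeasurable

lemma integrableAtFilter_one_div_sqrt (hk : Measurable k) {x d : ℝ} (hd : HasDerivAt k d x)
    (hd0 : k x = 0 → d ≠ 0) : IntegrableAtFilter (fun v => 1 / (k v : ℂ).sqrt) (𝓝 x) := by
  have hm : StronglyMeasurableAtFilter (fun v => 1 / (k v : ℂ).sqrt) (𝓝 x) volume :=
    (stronglyMeasurable_one_div_sqrt hk).stronglyMeasurableAtFilter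
  by_cases hx : k x = 0
  · have hlin : (fun v => v - x) =O[𝓝 x] k := by
      simpa only [Function.comp_def, id, hx, sub_zero] using
        (hd.isTheta_sub (hd0 hx)).2.comp_tendsto (tendsto_id.prodMk
          (tendsto_const_pure (b := x)))
    have hsqrt := hlin.norm_norm.rpow one_half_pos.le (Eventually.of_forall fun _ => norm_nonneg _)
    have hzero : ∀ v, ‖v - x‖ ^ (1 / 2 : ℝ) = 0 → ‖k v‖ ^ (1 / 2 : ℝ) = 0 := fun v hv => by
      rw [Real.rpow_eq_zero (norm_nonneg _) (by norm_num), norm_eq_zero, sub_eq_zero] at hv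
      simp [hv, hx]
    have hinv := hsqrt.inv_rev (Eventually.of_forall hzero)
    refine Asymptotics.IsBigO.integrableAtFilter ?_ hm (integrableAtFilter_norm_sub_rpow_neg_half x)
    refine Asymptotics.IsBigO.of_norm_left ?_
    simpa only [norm_div, norm_inv, norm_one, norm_complexSqrt, Complex.norm_real, one_div,
      Real.rpow_neg (norm_nonneg _)] using hinv
  · exact (continuousAt_one_div_sqrt hd.continuousAt hx).tendsto.integrableAtFilter hm
      (volume.finiteAt_nhds x)

lemma intervalIntegrable_one_div_sqrt {k' : ℝ → ℝ} (hk : ∀ x, HasDerivAt k (k' x) x)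
    (hk' : ∀ x, k x = 0 → k' x ≠ 0) (a b : ℝ) :
    IntervalIntegrable (fun v => 1 / (k v : ℂ).sqrt) volume a b := by
  have hc : Continuous k := continuous_iff_continuousAt.2 fun x => (hk x).continuousAt
  have : LocallyIntegrable (fun v => 1 / (k v : ℂ).sqrt) := fun x =>
    integrableAtFilter_one_div_sqrt hc.measurable (hk x) (hk' x)
  exact (this.integrableOn_isCompact isCompact_uIcc).intervalIntegrable

end InverseSqrtOfSimpleZeros

/-- A form of Grönwall's inequality in which the coefficient is only integrable. -/
lemma eq_zero_of_norm_deriv_le_mul {E : Type*} [NormedAddCommGroup E] [NormedSpace ℝ E]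
    {f : ℝ → E} {κ : ℝ → ℝ} {a b : ℝ} (hab : a ≤ b) (hf : ContinuousOn f (Icc a b))
    (hfa : f a = 0) (hf' : ∀ t ∈ Ioo a b, DifferentiableAt ℝ f t)
    (hbound : ∀ t ∈ Ioo a b, ‖deriv f t‖ ≤ κ t * ‖f t‖) (hκ0 : ∀ t, 0 ≤ κ t)
    (hκ : IntervalIntegrable κ volume a b) (hκ1 : ∫ t in a..b, κ t < 1) : f b = 0 := by
  obtain ⟨m, hm, hmax⟩ := isCompact_Icc.exists_isMaxOn (nonempty_Icc.2 hab) hf.norm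
  have hsub : Icc a m ⊆ Icc a b := Icc_subset_Icc_right hm.2
  have hsub' : Ioo a m ⊆ Ioo a b := Ioo_subset_Ioo_right hm.2
  have hκm : IntervalIntegrable κ volume a m :=
    hκ.mono_set (by rwa [uIcc_of_le hm.1, uIcc_of_le hab])
  have hle : ‖f m - f a‖ ≤ ∫ t in a..m, κ t * ‖f m‖ :=
    norm_sub_le_integral_of_norm_deriv_le_of_le hm.1 (hf.mono hsub)
      (fun t ht => (hf' t (hsub' ht)).differentiableWithinAt)
      (Eventually.of_forall fun t ht => (hbound t (hsub' ht)).trans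
        (mul_le_mul_of_nonneg_left (hmax (Ioo_subset_Icc_self (hsub' ht))) (hκ0 t)))
      (hκm.mul_const _)
  have hint : ∫ t in a..m, κ t ≤ ∫ t in a..b, κ t :=
    intervalIntegral.integral_mono_interval le_rfl hm.1 hm.2 (Eventually.of_forall hκ0) hκ
  rw [hfa, sub_zero, intervalIntegral.integral_mul_const] at hle
  have hfm : ‖f m‖ = 0 := by nlinarith [norm_nonneg (f m)]
  exact norm_le_zero_iff.1 (hfm ▸ hmax (right_mem_Icc.2 hab))

section EllipticIntegral

/-- The elliptic integral `∫ dv / √(invQuartic c g₂ g₃ v)` from `0` to `u`, with the principal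
branch of the square root; `invWeierstrassP` is its inverse function. -/
noncomputable def ellipticIntegral (c g₂ g₃ u : ℝ) : ℂ :=
  ∫ v in 0..u, 1 / ((invQuartic c g₂ g₃ v : ℝ) : ℂ).sqrt

/-- The elliptic integral is inverted by `invWeierstrassP Λ c` at its upper bound `u`, where the
derivative of `invWeierstrassP Λ c` is the principal square root appearing in the integral. -/
structure InvertsEllipticIntegralAt (Λ : PeriodPair) (c g₂ g₃ u : ℝ) : Prop where
  mem_domain : ellipticIntegral c g₂ g₃ u ∈ invWeierstrassPDomain Λ c
  value_eq : invWeierstrassP Λ c (ellipticIntegral c g₂ g₃ u) = u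
  deriv_eq : deriv (invWeierstrassP Λ c) (ellipticIntegral c g₂ g₃ u) =
    ((invQuartic c g₂ g₃ u : ℝ) : ℂ).sqrt

variable {Λ : PeriodPair} {c g₂ g₃ : ℝ}

lemma ellipticIntegral_zero : ellipticIntegral c g₂ g₃ 0 = 0 := intervalIntegral.integral_same

lemma intervalIntegrable_one_div_sqrt_invQuartic (hdisc : g₂ ^ 3 - 27 * g₃ ^ 2 ≠ 0) (a b : ℝ) :
    IntervalIntegrable (fun v => 1 / ((invQuartic c g₂ g₃ v : ℝ) : ℂ).sqrt) volume a b :=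
  intervalIntegrable_one_div_sqrt (hasDerivAt_invQuartic c g₂ g₃)
    (fun _ hu => mul_ne_zero two_ne_zero (invQuarticHalfDeriv_ne_zero hdisc hu)) a b

lemma continuous_ellipticIntegral (hdisc : g₂ ^ 3 - 27 * g₃ ^ 2 ≠ 0) :
    Continuous (ellipticIntegral c g₂ g₃) :=
  intervalIntegral.continuous_primitive (intervalIntegrable_one_div_sqrt_invQuartic hdisc) 0

lemma hasDerivAt_ellipticIntegral (hdisc : g₂ ^ 3 - 27 * g₃ ^ 2 ≠ 0) {u : ℝ}
    (hu : invQuartic c g₂ g₃ u ≠ 0) :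
    HasDerivAt (ellipticIntegral c g₂ g₃) (1 / ((invQuartic c g₂ g₃ u : ℝ) : ℂ).sqrt) u := by
  have hcont := continuous_invQuartic c g₂ g₃
  exact intervalIntegral.integral_hasDerivAt_right
    (intervalIntegrable_one_div_sqrt_invQuartic hdisc 0 u)
    (stronglyMeasurable_one_div_sqrt hcont.measurable).stronglyMeasurableAtFilter
    (continuousAt_one_div_sqrt hcont.continuousAt hu)

lemma eventually_invQuartic_ne_zero (hdisc : g₂ ^ 3 - 27 * g₃ ^ 2 ≠ 0) (x : ℝ) :
    ∀ᶠ u in 𝓝[>] x, invQuartic c g₂ g₃ u ≠ 0 := by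
  by_cases hx : invQuartic c g₂ g₃ x = 0
  · exact ((hasDerivAt_invQuartic c g₂ g₃ x).eventually_ne
      (mul_ne_zero two_ne_zero (invQuarticHalfDeriv_ne_zero hdisc hx))).filter_mono
      (nhdsGT_le_nhdsNE x)
  · exact ((continuous_invQuartic c g₂ g₃).continuousAt.eventually_ne hx).filter_mono
      nhdsWithin_le_nhds

/-- The failure of `invWeierstrassP` and of its derivative to take at `ellipticIntegral c g₂ g₃ u`
the values required by `InvertsEllipticIntegralAt`. -/
noncomputable def inversionDefect (Λ : PeriodPair) (c g₂ g₃ u : ℝ) : ℂ × ℂ :=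
  (invWeierstrassP Λ c (ellipticIntegral c g₂ g₃ u) - u,
    deriv (invWeierstrassP Λ c) (ellipticIntegral c g₂ g₃ u) -
      ((invQuartic c g₂ g₃ u : ℝ) : ℂ).sqrt)

lemma invertsEllipticIntegralAt_iff {u : ℝ} : InvertsEllipticIntegralAt Λ c g₂ g₃ u ↔
    ellipticIntegral c g₂ g₃ u ∈ invWeierstrassPDomain Λ c ∧ inversionDefect Λ c g₂ g₃ u = 0 := by
  rw [inversionDefect, Prod.mk_eq_zero, sub_eq_zero, sub_eq_zero]
  exact ⟨fun h => ⟨h.1, h.2, h.3⟩, fun h => ⟨h.1, h.2.1, h.2.2⟩⟩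

lemma continuousAt_inversionDefect (hdisc : g₂ ^ 3 - 27 * g₃ ^ 2 ≠ 0) {u : ℝ}
    (hu : ellipticIntegral c g₂ g₃ u ∈ invWeierstrassPDomain Λ c) :
    ContinuousAt (inversionDefect Λ c g₂ g₃) u := by
  have hA := analyticAt_invWeierstrassP hu
  have hZ := (continuous_ellipticIntegral (c := c) hdisc).continuousAt (x := u)
  have hsqrt := (continuous_sqrt_ofReal.comp (continuous_invQuartic c g₂ g₃)).continuousAt (x := u)
  exact ((ContinuousAt.comp hA.continuousAt hZ).sub Complex.continuous_ofReal.continuousAt).prodMk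
    ((ContinuousAt.comp hA.deriv.continuousAt hZ).sub hsqrt)

lemma hasDerivAt_inversionDefect (hΛ₂ : Λ.g₂ = g₂) (hΛ₃ : Λ.g₃ = g₃)
    (hdisc : g₂ ^ 3 - 27 * g₃ ^ 2 ≠ 0) {u : ℝ}
    (hu : ellipticIntegral c g₂ g₃ u ∈ invWeierstrassPDomain Λ c)
    (hk : invQuartic c g₂ g₃ u ≠ 0) :
    HasDerivAt (inversionDefect Λ c g₂ g₃)
      ((1 / ((invQuartic c g₂ g₃ u : ℝ) : ℂ).sqrt) • ((inversionDefect Λ c g₂ g₃ u).2,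
        invQuarticHalfDeriv (c : ℂ) g₂ g₃ (invWeierstrassP Λ c (ellipticIntegral c g₂ g₃ u)) -
          invQuarticHalfDeriv (c : ℂ) g₂ g₃ u)) u := by
  have hA := analyticAt_invWeierstrassP hu
  have hZ := hasDerivAt_ellipticIntegral (c := c) hdisc hk
  have hvalue := hA.differentiableAt.hasDerivAt.comp_of_eq u hZ rfl
  have hderiv := hA.deriv.differentiableAt.hasDerivAt.comp_of_eq u hZ rfl
  have hsqrt := (hasDerivAt_sqrt_ofReal hk).scomp u (hasDerivAt_invQuartic c g₂ g₃ u)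
  rw [deriv_deriv_invWeierstrassP hu, hΛ₂, hΛ₃] at hderiv
  have hs : ((invQuartic c g₂ g₃ u : ℝ) : ℂ).sqrt ≠ 0 :=
    complexSqrt_eq_zero.not.2 (Complex.ofReal_ne_zero.2 hk)
  refine ((hvalue.sub (hasDerivAt_id u).ofReal_comp).prodMk (hderiv.sub hsqrt)).congr_deriv ?_
  rw [inversionDefect, ← ofReal_invQuarticHalfDeriv c g₂ g₃ u, Prod.smul_mk, smul_eq_mul,
    smul_eq_mul, Complex.real_smul]
  push_cast
  congr 1 <;> field_simp

lemma norm_smul_prod_sub_le {E : Type*} [NormedAddCommGroup E] [NormedSpace ℂ E] {h : E → E}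
    {K : NNReal} {s : Set E} (hh : LipschitzOnWith K h s) {p q : E} (hp : p ∈ s) (hq : q ∈ s)
    (a : ℂ) (w : E) : ‖a • (w, h p - h q)‖ ≤ ‖a‖ * max 1 K * ‖(p - q, w)‖ := by
  rw [norm_smul, mul_assoc]
  gcongr
  rw [Prod.norm_def, Prod.norm_def]
  refine max_le ?_ ((hh.norm_sub_le hp hq).trans ?_)
  · exact (le_max_right _ _).trans (le_mul_of_one_le_left (by positivity) (le_max_left _ _))
  · gcongr
    exacts [le_max_right _ _, le_max_left _ _]

lemma exists_norm_deriv_inversionDefect_le (hΛ₂ : Λ.g₂ = g₂) (hΛ₃ : Λ.g₃ = g₃)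
    (hdisc : g₂ ^ 3 - 27 * g₃ ^ 2 ≠ 0) {x : ℝ} (hx : InvertsEllipticIntegralAt Λ c g₂ g₃ x) :
    ∃ C : NNReal, ∀ᶠ u in 𝓝[>] x, DifferentiableAt ℝ (inversionDefect Λ c g₂ g₃) u ∧
      ‖deriv (inversionDefect Λ c g₂ g₃) u‖ ≤
        ‖1 / ((invQuartic c g₂ g₃ u : ℝ) : ℂ).sqrt‖ * C * ‖inversionDefect Λ c g₂ g₃ u‖ := by
  obtain ⟨K, s, hs, hK⟩ := ((contDiff_invQuarticHalfDeriv (c : ℂ) g₂ g₃ (n := 1)).contDiffAt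
    (x := (x : ℂ))).exists_lipschitzOnWith
  have hZ := (continuous_ellipticIntegral (c := c) hdisc).continuousAt (x := x)
  have hvalue : ∀ᶠ u in 𝓝 x, invWeierstrassP Λ c (ellipticIntegral c g₂ g₃ u) ∈ s :=
    (ContinuousAt.comp (analyticAt_invWeierstrassP hx.mem_domain).continuousAt hZ).eventually
      (by rwa [Function.comp_apply, hx.value_eq])
  refine ⟨max 1 K, ?_⟩
  filter_upwards [eventually_invQuartic_ne_zero (c := c) hdisc x,
    nhdsWithin_le_nhds (hZ.eventually (isOpen_invWeierstrassPDomain.mem_nhds hx.mem_domain)),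
    nhdsWithin_le_nhds hvalue,
    nhdsWithin_le_nhds (Complex.continuous_ofReal.continuousAt.eventually hs)]
    with u hku hu huv hus
  have hderiv := hasDerivAt_inversionDefect hΛ₂ hΛ₃ hdisc hu hku
  exact ⟨hderiv.differentiableAt, hderiv.deriv ▸ norm_smul_prod_sub_le hK huv hus _ _⟩

/-- Near a zero of the quartic the coefficient `1 / √invQuartic` in the bound on the derivative of
the defect is unbounded, but it is integrable. -/
lemma exists_gt_invertsEllipticIntegralAt (hΛ₂ : Λ.g₂ = g₂) (hΛ₃ : Λ.g₃ = g₃)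
    (hdisc : g₂ ^ 3 - 27 * g₃ ^ 2 ≠ 0) {x y : ℝ} (hx : InvertsEllipticIntegralAt Λ c g₂ g₃ x)
    (hxy : x < y) : ∃ v, InvertsEllipticIntegralAt Λ c g₂ g₃ v ∧ v ∈ Ioc x y := by
  obtain ⟨C, hC⟩ := exists_norm_deriv_inversionDefect_le hΛ₂ hΛ₃ hdisc hx
  have hκ (a b : ℝ) : IntervalIntegrable
      (fun u => ‖1 / ((invQuartic c g₂ g₃ u : ℝ) : ℂ).sqrt‖ * C) volume a b :=
    (intervalIntegrable_one_div_sqrt_invQuartic hdisc a b).norm.mul_const _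
  have hdom : ∀ᶠ u in 𝓝[>] x, ellipticIntegral c g₂ g₃ u ∈ invWeierstrassPDomain Λ c :=
    nhdsWithin_le_nhds ((continuous_ellipticIntegral hdisc).continuousAt.eventually
      (isOpen_invWeierstrassPDomain.mem_nhds hx.mem_domain))
  have hκ1 : ∀ᶠ v in 𝓝[>] x,
      ∫ u in x..v, ‖1 / ((invQuartic c g₂ g₃ u : ℝ) : ℂ).sqrt‖ * C < 1 :=
    nhdsWithin_le_nhds
      ((intervalIntegral.continuous_primitive hκ x).continuousAt.eventually_lt_const (by simp))
  obtain ⟨v, hxv, hv⟩ := mem_nhdsGT_iff_exists_Ioc_subset.1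
    (hC.and (hdom.and (hκ1.and (Ioc_mem_nhdsGT hxy))))
  obtain ⟨-, hvdom, hv1, hvxy⟩ := hv (right_mem_Ioc.2 hxv)
  refine ⟨v, invertsEllipticIntegralAt_iff.2 ⟨hvdom, ?_⟩, hvxy⟩
  refine eq_zero_of_norm_deriv_le_mul hvxy.1.le (fun u hu => ?_)
    (invertsEllipticIntegralAt_iff.1 hx).2 (fun u hu => (hv (Ioo_subset_Ioc_self hu)).1.1)
    (fun u hu => (hv (Ioo_subset_Ioc_self hu)).1.2) (fun u => by positivity) (hκ x v) hv1
  have hudom : ellipticIntegral c g₂ g₃ u ∈ invWeierstrassPDomain Λ c := by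
    rcases hu.1.eq_or_lt with rfl | hxu
    exacts [hx.mem_domain, (hv ⟨hxu, hu.2⟩).2.1]
  exact (continuousAt_inversionDefect hdisc hudom).continuousWithinAt

lemma invertsEllipticIntegralAt_zero : InvertsEllipticIntegralAt Λ c g₂ g₃ 0 := by
  refine invertsEllipticIntegralAt_iff.2 ⟨?_, ?_⟩
  · rw [ellipticIntegral_zero]
    exact Or.inl Λ.lattice.zero_mem
  · rw [inversionDefect, ellipticIntegral_zero, invWeierstrassP_of_mem Λ.lattice.zero_mem,
      deriv_invWeierstrassP_of_mem _ Λ.lattice.zero_mem, invQuartic_zero, Complex.ofReal_zero,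
      complexSqrt_eq_zero.2 rfl, sub_zero, Prod.mk_zero_zero]

lemma isClosed_setOf_invertsEllipticIntegralAt (hdisc : g₂ ^ 3 - 27 * g₃ ^ 2 ≠ 0) :
    IsClosed {u | InvertsEllipticIntegralAt Λ c g₂ g₃ u} := by
  refine IsSeqClosed.isClosed fun w v hw hwv => ?_
  have hZ := ((continuous_ellipticIntegral (c := c) hdisc).tendsto v).comp hwv
  have hvalue := (Complex.continuous_ofReal.tendsto v).comp hwv
  have hderiv := ((continuous_sqrt_ofReal.comp (continuous_invQuartic c g₂ g₃)).tendsto v).comp hwv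
  obtain ⟨h1, h2, h3⟩ := invWeierstrassP_eq_of_tendsto hZ (fun n => (hw n).mem_domain)
    (hvalue.congr fun n => (hw n).value_eq.symm) (hderiv.congr fun n => (hw n).deriv_eq.symm)
  exact ⟨h1, h2, h3⟩

theorem invertsEllipticIntegralAt_of_nonneg (hΛ₂ : Λ.g₂ = g₂) (hΛ₃ : Λ.g₃ = g₃)
    (hdisc : g₂ ^ 3 - 27 * g₃ ^ 2 ≠ 0) {u : ℝ} (hu : 0 ≤ u) :
    InvertsEllipticIntegralAt Λ c g₂ g₃ u :=
  ((isClosed_setOf_invertsEllipticIntegralAt hdisc).inter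
    isClosed_Icc).Icc_subset_of_forall_exists_gt invertsEllipticIntegralAt_zero
    (fun _ hx _ hxy => exists_gt_invertsEllipticIntegralAt hΛ₂ hΛ₃ hdisc hx.1 hxy)
    (right_mem_Icc.2 hu)

end EllipticIntegral

section SecondOrderODE

variable {E : Type*} [NormedAddCommGroup E] [NormedSpace ℝ E]

/-- At `t`, the curve `u` with velocity `u'` solves the autonomous second order equation
`u'' = F u`. -/
structure SolvesSecondOrderAt (F : E → E) (u u' : ℝ → E) (t : ℝ) : Prop where
  hasDerivAt : HasDerivAt u (u' t) t
  hasDerivAt_velocity : HasDerivAt u' (F (u t)) t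

variable {F : E → E} {u u' v v' : ℝ → E} {t₀ : ℝ}

lemma SolvesSecondOrderAt.eventuallyEq (hF : ContDiffAt ℝ 1 F (u t₀))
    (hu : ∀ᶠ t in 𝓝 t₀, SolvesSecondOrderAt F u u' t)
    (hv : ∀ᶠ t in 𝓝 t₀, SolvesSecondOrderAt F v v' t) (h : u t₀ = v t₀) (h' : u' t₀ = v' t₀) :
    ∀ᶠ t in 𝓝 t₀, u t = v t ∧ u' t = v' t := by
  let G : E × E → E × E := fun p => (p.2, F p.1)
  have hG : ContDiffAt ℝ 1 G (u t₀, u' t₀) :=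
    contDiffAt_snd.prodMk (hF.comp (u t₀, u' t₀) contDiffAt_fst)
  obtain ⟨K, s, hs, hK⟩ := hG.exists_lipschitzOnWith
  have phase {w w' : ℝ → E} (hs : s ∈ 𝓝 (w t₀, w' t₀))
      (hw : ∀ᶠ t in 𝓝 t₀, SolvesSecondOrderAt F w w' t) :
      ∀ᶠ t in 𝓝 t₀, HasDerivAt (fun t => (w t, w' t)) (G (w t, w' t)) t ∧ (w t, w' t) ∈ s := by
    have hcont := hw.self_of_nhds.hasDerivAt.continuousAt.prodMk
      hw.self_of_nhds.hasDerivAt_velocity.continuousAt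
    filter_upwards [hw, hcont.eventually hs] with t ht hts
    exact ⟨ht.hasDerivAt.prodMk ht.hasDerivAt_velocity, hts⟩
  have := ODE_solution_unique_of_eventually (v := fun _ => G) (s := fun _ => s)
    (Eventually.of_forall fun _ => hK) (phase hs hu) (phase (by rwa [← h, ← h']) hv) (by rw [h, h'])
  exact this.mono fun t ht => Prod.mk_inj.1 ht

end SecondOrderODE

section Line

variable {Λ : PeriodPair} {c z₀ : ℂ}

lemma eventually_add_ofReal_mem_invWeierstrassPDomain {t : ℝ}
    (ht : z₀ + t ∈ invWeierstrassPDomain Λ c) :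
    ∀ᶠ s : ℝ in 𝓝 t, z₀ + s ∈ invWeierstrassPDomain Λ c :=
  (continuous_const.add Complex.continuous_ofReal).continuousAt.eventually
    (isOpen_invWeierstrassPDomain.mem_nhds ht)

lemma solvesSecondOrderAt_invWeierstrassP {t : ℝ} (ht : z₀ + t ∈ invWeierstrassPDomain Λ c) :
    SolvesSecondOrderAt (invQuarticHalfDeriv c Λ.g₂ Λ.g₃)
      (fun s => invWeierstrassP Λ c (z₀ + s))
      (fun s => deriv (invWeierstrassP Λ c) (z₀ + s)) t where
  hasDerivAt := ((analyticAt_invWeierstrassP ht).differentiableAt.hasDerivAt.comp_const_add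
    z₀ t).comp_ofReal
  hasDerivAt_velocity := by
    rw [← deriv_deriv_invWeierstrassP ht]
    exact ((analyticAt_invWeierstrassP ht).deriv.differentiableAt.hasDerivAt.comp_const_add
      z₀ t).comp_ofReal

lemma eq_invWeierstrassP_of_solvesSecondOrder {J : Set ℝ} (hJo : IsOpen J) (hJc : IsPreconnected J)
    {u u' : ℝ → ℂ} (hu : ∀ x ∈ J, SolvesSecondOrderAt (invQuarticHalfDeriv c Λ.g₂ Λ.g₃) u u' x)
    {x₀ : ℝ} (hx₀ : x₀ ∈ J) (hdom : z₀ + x₀ ∈ invWeierstrassPDomain Λ c)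
    (hvalue : invWeierstrassP Λ c (z₀ + x₀) = u x₀)
    (hderiv : deriv (invWeierstrassP Λ c) (z₀ + x₀) = u' x₀) {x : ℝ} (hx : x ∈ J) :
    z₀ + x ∈ invWeierstrassPDomain Λ c ∧ invWeierstrassP Λ c (z₀ + x) = u x := by
  let S : Set ℝ := {x | x ∈ J ∧ z₀ + x ∈ invWeierstrassPDomain Λ c ∧
    invWeierstrassP Λ c (z₀ + x) = u x ∧ deriv (invWeierstrassP Λ c) (z₀ + x) = u' x}
  suffices J ⊆ S from ⟨(this hx).2.1, (this hx).2.2.1⟩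
  refine hJc.subset_of_closure_inter_subset ?_ ⟨x₀, hx₀, hx₀, hdom, hvalue, hderiv⟩ ?_
  · refine isOpen_iff_mem_nhds.2 fun y ⟨hyJ, hydom, hy, hy'⟩ => ?_
    have hdom_near := eventually_add_ofReal_mem_invWeierstrassPDomain hydom
    have hJ_near : ∀ᶠ t in 𝓝 y, t ∈ J := hJo.mem_nhds hyJ
    filter_upwards [hJ_near, hdom_near, SolvesSecondOrderAt.eventuallyEq
      ((contDiff_invQuarticHalfDeriv c Λ.g₂ Λ.g₃).restrict_scalars ℝ).contDiffAt
      (hdom_near.mono fun _ => solvesSecondOrderAt_invWeierstrassP) (hJ_near.mono hu) hy hy']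
      with t ht htdom hteq
    exact ⟨ht, htdom, hteq⟩
  · rintro y ⟨hyS, hyJ⟩
    obtain ⟨t, htS, hty⟩ := mem_closure_iff_seq_limit.1 hyS
    have hz : Tendsto (fun n => z₀ + (t n : ℂ)) atTop (𝓝 (z₀ + y)) :=
      ((Complex.continuous_ofReal.tendsto y).comp hty).const_add z₀
    exact ⟨hyJ, invWeierstrassP_eq_of_tendsto hz (fun n => (htS n).2.1)
      (((hu y hyJ).hasDerivAt.continuousAt.tendsto.comp hty).congr fun n => (htS n).2.2.1.symm)
      (((hu y hyJ).hasDerivAt_velocity.continuousAt.tendsto.comp hty).congr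
        fun n => (htS n).2.2.2.symm)⟩

end Line

section CarlsonSubstitution

lemma image_one_div_one_add_Ioi : (fun ζ : ℝ => 1 / (1 + ζ)) '' Ioi 0 = Ioo 0 1 := by
  ext u
  simp only [mem_image, mem_Ioi, mem_Ioo]
  constructor
  · rintro ⟨ζ, hζ, rfl⟩
    exact ⟨by positivity, (div_lt_one (by positivity)).2 (lt_add_of_pos_right 1 hζ)⟩
  · rintro ⟨h0, h1⟩
    exact ⟨1 / u - 1, sub_pos.2 ((one_lt_div h0).2 h1), by simp⟩

lemma hasDerivAt_one_div_one_add {ζ : ℝ} (hζ : 1 + ζ ≠ 0) :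
    HasDerivAt (fun ζ : ℝ => 1 / (1 + ζ)) (-(1 / (1 + ζ)) ^ 2) ζ := by
  simp only [one_div]
  exact (((hasDerivAt_id ζ).const_add 1).fun_inv hζ).congr_deriv (by simp [neg_div])

lemma integral_comp_one_div_one_add (f : ℝ → ℂ) :
    ∫ ζ in Ioi (0 : ℝ), |-(1 / (1 + ζ)) ^ 2| • f (1 / (1 + ζ)) = ∫ u in Ioo 0 1, f u := by
  rw [← image_one_div_one_add_Ioi]
  exact (integral_image_eq_integral_abs_deriv_smul measurableSet_Ioi
    (fun ζ hζ => (hasDerivAt_one_div_one_add (add_pos one_pos hζ).ne').hasDerivWithinAt)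
    (fun x _ y _ h => by simpa using h) f).symm

lemma integrableOn_comp_one_div_one_add {f : ℝ → ℂ} :
    IntegrableOn (fun ζ => |-(1 / (1 + ζ)) ^ 2| • f (1 / (1 + ζ))) (Ioi 0) ↔
      IntegrableOn f (Ioo 0 1) := by
  rw [← image_one_div_one_add_Ioi]
  exact (integrableOn_image_iff_integrableOn_abs_deriv_smul measurableSet_Ioi
    (fun ζ hζ => (hasDerivAt_one_div_one_add (add_pos one_pos hζ).ne').hasDerivWithinAt)
    (fun x _ y _ h => by simpa using h) f).symm

end CarlsonSubstitution

section Carlson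

open RNdS

variable {g₂ g₃ wp₀ : ℝ} {z₁ z₂ z₃ : ℂ}

lemma carlsonIntegrand_eq_invQuartic
    (hz : ∀ s : ℂ, 4 * s ^ 3 - g₂ * s - g₃ = 4 * ((s - z₁) * (s - z₂) * (s - z₃))) {ζ : ℝ}
    (hζ : 0 < ζ) :
    carlsonIntegrand (wp₀ - z₁) (wp₀ - z₂) (wp₀ - z₃) ζ =
      2 * (|-(1 / (1 + ζ)) ^ 2| •
        (1 / ((invQuartic (wp₀ - 1) g₂ g₃ (1 / (1 + ζ)) : ℝ) : ℂ).sqrt)) := by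
  have hu : 0 < 1 / (1 + ζ) := by positivity
  have hprod : ((ζ : ℂ) + (wp₀ - z₁)) * (ζ + (wp₀ - z₂)) * (ζ + (wp₀ - z₃)) =
      (((1 / 2) ^ 2 * (4 * (wp₀ + ζ) ^ 3 - g₂ * (wp₀ + ζ) - g₃) : ℝ) : ℂ) := by
    push_cast
    linear_combination -hz (wp₀ + ζ) / 4
  have hquartic : invQuartic (wp₀ - 1) g₂ g₃ (1 / (1 + ζ)) =
      ((1 / (1 + ζ)) ^ 2) ^ 2 * (4 * (wp₀ + ζ) ^ 3 - g₂ * (wp₀ + ζ) - g₃) := by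
    rw [invQuartic_eq_pow_mul _ _ _ hu.ne', one_div_one_div, ← add_assoc, sub_add_cancel,
      ← pow_mul]
  have hsqrt (w : ℂ) : w ^ (1 / 2 : ℂ) = w.sqrt := by rw [Complex.sqrt, one_div]
  rw [carlsonIntegrand, hprod, hsqrt, sqrt_ofReal_sq_mul (by norm_num),
    hquartic, sqrt_ofReal_sq_mul (sq_nonneg _), abs_neg, abs_of_nonneg (sq_nonneg _),
    Complex.real_smul, mul_one_div, div_mul_cancel_left₀ (Complex.ofReal_ne_zero.2 (by positivity)),
    one_div, mul_inv]
  norm_num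

lemma integrableOn_carlsonIntegrand (hdisc : g₂ ^ 3 - 27 * g₃ ^ 2 ≠ 0)
    (hz : ∀ s : ℂ, 4 * s ^ 3 - g₂ * s - g₃ = 4 * ((s - z₁) * (s - z₂) * (s - z₃))) :
    IntegrableOn (carlsonIntegrand (wp₀ - z₁) (wp₀ - z₂) (wp₀ - z₃)) (Ioi 0) := by
  have hint : IntegrableOn (fun u => 1 / ((invQuartic (wp₀ - 1) g₂ g₃ u : ℝ) : ℂ).sqrt)
      (Ioo 0 1) :=
    (intervalIntegrable_iff_integrableOn_Ioo_of_le zero_le_one).1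
      (intervalIntegrable_one_div_sqrt_invQuartic hdisc 0 1)
  exact IntegrableOn.congr_fun ((integrableOn_comp_one_div_one_add.2 hint).const_mul 2)
    (fun _ hζ => (carlsonIntegrand_eq_invQuartic hz hζ).symm) measurableSet_Ioi

lemma carlsonRF_eq_ellipticIntegral
    (hz : ∀ s : ℂ, 4 * s ^ 3 - g₂ * s - g₃ = 4 * ((s - z₁) * (s - z₂) * (s - z₃))) :
    carlsonRF (wp₀ - z₁) (wp₀ - z₂) (wp₀ - z₃) = ellipticIntegral (wp₀ - 1) g₂ g₃ 1 := by
  rw [carlsonRF,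
    setIntegral_congr_fun measurableSet_Ioi fun _ => carlsonIntegrand_eq_invQuartic hz,
    integral_const_mul,
    integral_comp_one_div_one_add fun u => 1 / ((invQuartic (wp₀ - 1) g₂ g₃ u : ℝ) : ℂ).sqrt,
    ellipticIntegral, intervalIntegral.integral_of_le zero_le_one, integral_Ioc_eq_integral_Ioo]
  ring

variable {Λ : PeriodPair}

theorem weierstrassP_carlsonRF (hΛ₂ : Λ.g₂ = g₂) (hΛ₃ : Λ.g₃ = g₃)
    (hdisc : g₂ ^ 3 - 27 * g₃ ^ 2 ≠ 0)
    (hz : ∀ s : ℂ, 4 * s ^ 3 - g₂ * s - g₃ = 4 * ((s - z₁) * (s - z₂) * (s - z₃))) :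
    carlsonRF (wp₀ - z₁) (wp₀ - z₂) (wp₀ - z₃) ∉ Λ.lattice ∧
    Λ.weierstrassP (carlsonRF (wp₀ - z₁) (wp₀ - z₂) (wp₀ - z₃)) = wp₀ ∧
    Λ.derivWeierstrassP (carlsonRF (wp₀ - z₁) (wp₀ - z₂) (wp₀ - z₃)) =
      -((4 * wp₀ ^ 3 - g₂ * wp₀ - g₃ : ℝ) : ℂ).sqrt := by
  rw [carlsonRF_eq_ellipticIntegral hz]
  obtain ⟨hdom, hvalue, hderiv⟩ :=
    invertsEllipticIntegralAt_of_nonneg (c := wp₀ - 1) hΛ₂ hΛ₃ hdisc zero_le_one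
  set z := ellipticIntegral (wp₀ - 1) g₂ g₃ 1
  have hl : z ∉ Λ.lattice := fun h => by simp [invWeierstrassP_of_mem h] at hvalue
  have hP : Λ.weierstrassP z - (wp₀ - 1 : ℝ) = 1 := by
    rw [invWeierstrassP_of_notMem hl, Complex.ofReal_one, one_div, inv_eq_one] at hvalue
    exact hvalue
  rw [deriv_invWeierstrassP_of_notMem hl (hdom.resolve_left hl), hP, one_pow, div_one,
    invQuartic_eq_pow_mul _ _ _ one_ne_zero, one_pow, one_mul, div_one, sub_add_cancel] at hderiv
  refine ⟨hl, ?_, neg_eq_iff_eq_neg.1 hderiv⟩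
  push_cast at hP
  linear_combination hP

theorem weierstrassP_signed_carlsonRF (hΛ₂ : Λ.g₂ = g₂) (hΛ₃ : Λ.g₃ = g₃)
    (hdisc : g₂ ^ 3 - 27 * g₃ ^ 2 ≠ 0)
    (hz : ∀ s : ℂ, 4 * s ^ 3 - g₂ * s - g₃ = 4 * ((s - z₁) * (s - z₂) * (s - z₃)))
    {q : ℝ} (hq : 4 * wp₀ ^ 3 - g₂ * wp₀ - g₃ = q ^ 2) {z₀ : ℂ}
    (hz₀ : z₀ = (if 0 ≤ q then 1 else -1) * carlsonRF (wp₀ - z₁) (wp₀ - z₂) (wp₀ - z₃)) :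
    z₀ ∉ Λ.lattice ∧ Λ.weierstrassP z₀ = wp₀ ∧ Λ.derivWeierstrassP z₀ = -q := by
  obtain ⟨hl, hP, hP'⟩ := weierstrassP_carlsonRF (wp₀ := wp₀) hΛ₂ hΛ₃ hdisc hz
  rw [hq, sqrt_ofReal_of_nonneg (sq_nonneg q), Real.sqrt_sq_eq_abs] at hP'
  split_ifs at hz₀ with hs
  · rw [hz₀, one_mul, hP', abs_of_nonneg hs]
    exact ⟨hl, hP, rfl⟩
  · rw [hz₀, neg_one_mul, Λ.weierstrassP_neg, Λ.derivWeierstrassP_neg, hP',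
      abs_of_neg (not_le.1 hs), Complex.ofReal_neg, neg_neg]
    exact ⟨neg_mem_iff.not.2 hl, hP, rfl⟩

end Carlson

namespace RNdS

section Christoffel

open Matrix

variable {n : ℕ} (g : (Fin n → ℝ) → Matrix (Fin n) (Fin n) ℝ)

/-- The matrix of the `α`-th partial derivatives of the coefficients of the metric `g` at `x`. -/
noncomputable def metricPderiv (α : Fin n) (x : Fin n → ℝ) : Matrix (Fin n) (Fin n) ℝ :=
  Matrix.of fun μ ν => pderiv (fun y => g y μ ν) α x

lemma sum_christoffel_mul_mul (x v : Fin n → ℝ) (μ : Fin n) :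
    ∑ α, ∑ β, christoffel g μ α β x * v α * v β =
      ∑ ν, (g x)⁻¹ μ ν * (∑ α, v α * (metricPderiv g α x *ᵥ v) ν
        - (v ⬝ᵥ metricPderiv g ν x *ᵥ v) / 2) := by
  have hmixed (ν : Fin n) : ∑ α, v α * (metricPderiv g α x *ᵥ v) ν =
      ∑ α, ∑ β, pderiv (fun y => g y ν β) α x * v α * v β := by
    simp only [mulVec, dotProduct, metricPderiv, of_apply, Finset.mul_sum]
    exact Finset.sum_congr rfl fun _ _ => Finset.sum_congr rfl fun _ _ => by ring
  have hquad (ν : Fin n) : v ⬝ᵥ metricPderiv g ν x *ᵥ v =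
      ∑ α, ∑ β, pderiv (fun y => g y α β) ν x * v α * v β := by
    simp only [mulVec, dotProduct, metricPderiv, of_apply, Finset.mul_sum]
    exact Finset.sum_congr rfl fun _ _ => Finset.sum_congr rfl fun _ _ => by ring
  have hswap (ν : Fin n) : ∑ α, ∑ β, pderiv (fun y => g y ν α) β x * v α * v β =
      ∑ α, v α * (metricPderiv g α x *ᵥ v) ν := by
    rw [hmixed, Finset.sum_comm]
    exact Finset.sum_congr rfl fun _ _ => Finset.sum_congr rfl fun _ _ => mul_right_comm _ _ _
  calc ∑ α, ∑ β, christoffel g μ α β x * v α * v β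
      = ∑ ν, 1 / 2 * (g x)⁻¹ μ ν * (∑ α, ∑ β, pderiv (fun y => g y ν β) α x * v α * v β
          + ∑ α, ∑ β, pderiv (fun y => g y ν α) β x * v α * v β
          - ∑ α, ∑ β, pderiv (fun y => g y α β) ν x * v α * v β) := by
        simp only [christoffel, ← Finset.sum_add_distrib, ← Finset.sum_sub_distrib, Finset.mul_sum,
          Finset.sum_mul]
        rw [Finset.sum_comm_cycle]
        exact Finset.sum_congr rfl fun _ _ => Finset.sum_congr rfl fun _ _ =>
          Finset.sum_congr rfl fun _ _ => by ring
    _ = _ := Finset.sum_congr rfl fun ν _ => by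
        rw [hswap, ← hmixed, ← hquad]
        ring

end Christoffel

section Metric

open Matrix

variable {lam M Q : ℝ}

/-- The derivative of `horizonFn`. -/
noncomputable def horizonFnDeriv (lam M Q r : ℝ) : ℝ :=
  -(2 * lam * r) + 2 * M / r ^ 2 - 2 * Q ^ 2 / r ^ 3

lemma hasDerivAt_horizonFn (lam M Q : ℝ) {r : ℝ} (hr : r ≠ 0) :
    HasDerivAt (horizonFn lam M Q) (horizonFnDeriv lam M Q r) r := by
  have hid := hasDerivAt_id r
  have h := ((((hid.pow 2).const_mul lam).const_sub 1).sub
    ((hasDerivAt_const r (2 * M)).div hid hr)).add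
    ((hasDerivAt_const r (Q ^ 2)).div (hid.pow 2) (pow_ne_zero 2 hr))
  refine h.congr_deriv ?_
  simp only [id, horizonFnDeriv, Pi.pow_apply]
  field_simp
  ring

/-- The coefficient `g_{wr}` of the metric on a patch; in terms of it the three forms of the metric
have a single expression, see `metric_eq`. -/
def Patch.sign : Patch → ℝ
  | .static => 0
  | .ingoing => 1
  | .outgoing => -1

lemma metric_eq (p : Patch) (x : Fin 4 → ℝ) :
    metric lam M Q p x =
      !![-horizonFn lam M Q (x 1), p.sign, 0, 0;
         p.sign, (1 - p.sign ^ 2) / horizonFn lam M Q (x 1), 0, 0;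
         0, 0, x 1 ^ 2, 0;
         0, 0, 0, x 1 ^ 2 * Real.sin (x 2) ^ 2] := by
  cases p <;> simp [metric, Patch.sign]

variable {p : Patch} {x : Fin 4 → ℝ}

lemma radius_ne_zero (hx : x ∈ domain lam M Q p) : x 1 ≠ 0 := by
  cases p <;> exact hx.1

lemma sin_ne_zero (hx : x ∈ domain lam M Q p) : Real.sin (x 2) ≠ 0 := by
  cases p
  · exact hx.2.1
  all_goals exact hx.2

lemma horizonFn_ne_zero_or_sign_sq (hx : x ∈ domain lam M Q p) :
    horizonFn lam M Q (x 1) ≠ 0 ∨ p.sign ^ 2 = 1 := by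
  cases p
  · exact Or.inl hx.2.2
  all_goals exact Or.inr (by norm_num [Patch.sign])

lemma one_sub_sign_sq_div_mul (hx : x ∈ domain lam M Q p) :
    (1 - p.sign ^ 2) / horizonFn lam M Q (x 1) * horizonFn lam M Q (x 1) = 1 - p.sign ^ 2 := by
  rcases horizonFn_ne_zero_or_sign_sq hx with hΔ | hσ
  · exact div_mul_cancel₀ _ hΔ
  · rw [hσ, sub_self, zero_div, zero_mul]

lemma inv_metric (hx : x ∈ domain lam M Q p) :
    (metric lam M Q p x)⁻¹ =
      !![-((1 - p.sign ^ 2) / horizonFn lam M Q (x 1)), p.sign, 0, 0;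
         p.sign, horizonFn lam M Q (x 1), 0, 0;
         0, 0, 1 / x 1 ^ 2, 0;
         0, 0, 0, 1 / (x 1 ^ 2 * Real.sin (x 2) ^ 2)] := by
  have hr := radius_ne_zero hx
  have hs := sin_ne_zero hx
  have hσ := one_sub_sign_sq_div_mul hx
  refine inv_eq_right_inv ?_
  rw [metric_eq]
  generalize (1 - p.sign ^ 2) / horizonFn lam M Q (x 1) = k at *
  ext i j
  rw [mul_apply, Fin.sum_univ_four]
  fin_cases i <;> fin_cases j <;>
    simp only [Fin.isValue, Fin.zero_eta, Fin.mk_one, Fin.reduceFinMk, of_apply, cons_val',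
      cons_val_zero, cons_val_fin_one, cons_val_one, cons_val, one_apply, Fin.reduceEq, if_true,
      if_false, mul_zero, zero_mul, add_zero, zero_add] <;>
    first | linear_combination hσ | ring1 | field_simp

lemma metricPderiv_metric_zero (p : Patch) (x : Fin 4 → ℝ) :
    metricPderiv (metric lam M Q p) 0 x = 0 := by
  ext μ ν
  simp [metricPderiv, pderiv, metric_eq]

lemma metricPderiv_metric_three (p : Patch) (x : Fin 4 → ℝ) :
    metricPderiv (metric lam M Q p) 3 x = 0 := by
  ext μ ν
  simp [metricPderiv, pderiv, metric_eq]

lemma hasDerivAt_one_sub_sign_sq_div (hx : x ∈ domain lam M Q p) :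
    HasDerivAt (fun r => (1 - p.sign ^ 2) / horizonFn lam M Q r)
      (-((1 - p.sign ^ 2) * horizonFnDeriv lam M Q (x 1) / horizonFn lam M Q (x 1) ^ 2)) (x 1) := by
  rcases horizonFn_ne_zero_or_sign_sq hx with hΔ | hσ
  · exact ((hasDerivAt_const (x 1) _).div (hasDerivAt_horizonFn lam M Q (radius_ne_zero hx))
      hΔ).congr_deriv (by ring)
  · simpa [hσ] using hasDerivAt_const (x 1) (0 : ℝ)

lemma metricPderiv_metric_one (hx : x ∈ domain lam M Q p) :
    metricPderiv (metric lam M Q p) 1 x =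
      !![-horizonFnDeriv lam M Q (x 1), 0, 0, 0;
         0, -((1 - p.sign ^ 2) * horizonFnDeriv lam M Q (x 1) / horizonFn lam M Q (x 1) ^ 2), 0, 0;
         0, 0, 2 * x 1, 0;
         0, 0, 0, 2 * x 1 * Real.sin (x 2) ^ 2] := by
  have hΔ := (hasDerivAt_horizonFn lam M Q (radius_ne_zero hx)).deriv
  have hσ := (hasDerivAt_one_sub_sign_sq_div hx).deriv
  ext μ ν
  fin_cases μ <;> fin_cases ν <;>
    simp [metricPderiv, pderiv, metric_eq, Function.update_of_ne, hΔ, hσ]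

lemma metric_mulVec (hequator : x 2 = Real.pi / 2) {v : Fin 4 → ℝ} (hv : v 2 = 0) :
    metric lam M Q p x *ᵥ v =
      ![-horizonFn lam M Q (x 1) * v 0 + p.sign * v 1,
        p.sign * v 0 + (1 - p.sign ^ 2) / horizonFn lam M Q (x 1) * v 1, 0, x 1 ^ 2 * v 3] := by
  rw [metric_eq, hequator, Real.sin_pi_div_two]
  ext μ
  fin_cases μ <;> simp [mulVec, dotProduct, Fin.sum_univ_four, hv]

lemma metricPderiv_metric_one_mulVec (hx : x ∈ domain lam M Q p) (hequator : x 2 = Real.pi / 2)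
    {v : Fin 4 → ℝ} (hv : v 2 = 0) :
    metricPderiv (metric lam M Q p) 1 x *ᵥ v =
      ![-horizonFnDeriv lam M Q (x 1) * v 0,
        -((1 - p.sign ^ 2) * horizonFnDeriv lam M Q (x 1) / horizonFn lam M Q (x 1) ^ 2) * v 1,
        0, 2 * x 1 * v 3] := by
  rw [metricPderiv_metric_one hx, hequator, Real.sin_pi_div_two]
  ext μ
  fin_cases μ <;> simp [mulVec, dotProduct, Fin.sum_univ_four, hv]

lemma metric_mulVec_dotProduct (hequator : x 2 = Real.pi / 2) {v : Fin 4 → ℝ} (hv : v 2 = 0) :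
    (metric lam M Q p x *ᵥ v) ⬝ᵥ v =
      -horizonFn lam M Q (x 1) * v 0 ^ 2 + 2 * p.sign * v 0 * v 1
        + (1 - p.sign ^ 2) / horizonFn lam M Q (x 1) * v 1 ^ 2 + x 1 ^ 2 * v 3 ^ 2 := by
  simp only [metric_mulVec hequator hv, dotProduct, Fin.sum_univ_four, cons_val, hv]
  ring

lemma sum_christoffel_radial (hx : x ∈ domain lam M Q p) (hequator : x 2 = Real.pi / 2)
    {v : Fin 4 → ℝ} (hv : v 2 = 0) :
    ∑ α, ∑ β, christoffel (metric lam M Q p) 1 α β x * v α * v β =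
      -horizonFnDeriv lam M Q (x 1) / 2 *
          ((metric lam M Q p x *ᵥ v) ⬝ᵥ v - x 1 ^ 2 * v 3 ^ 2)
        - x 1 * horizonFn lam M Q (x 1) * v 3 ^ 2 := by
  have hinv : (metric lam M Q p x)⁻¹ 1 = ![p.sign, horizonFn lam M Q (x 1), 0, 0] := by
    rw [inv_metric hx]
    rfl
  set D := metricPderiv (metric lam M Q p) 1 x with hD
  have hcontract : ∑ α, ∑ β, christoffel (metric lam M Q p) 1 α β x * v α * v β =
      p.sign * (v 1 * (D *ᵥ v) 0) +
        horizonFn lam M Q (x 1) * (v 1 * (D *ᵥ v) 1 - (v ⬝ᵥ D *ᵥ v) / 2) := by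
    rw [sum_christoffel_mul_mul]
    simp [hinv, Fin.sum_univ_four, hv, metricPderiv_metric_zero, metricPderiv_metric_three, ← hD]
  have hcancel : horizonFn lam M Q (x 1) * ((1 - p.sign ^ 2) * horizonFnDeriv lam M Q (x 1) /
      horizonFn lam M Q (x 1) ^ 2) =
        (1 - p.sign ^ 2) / horizonFn lam M Q (x 1) * horizonFnDeriv lam M Q (x 1) := by
    field_simp
  rw [hcontract, metricPderiv_metric_one_mulVec hx hequator hv,
    metric_mulVec_dotProduct hequator hv]
  simp only [dotProduct, Fin.sum_univ_four, cons_val, hv]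
  linear_combination -(v 1 ^ 2 / 2) * hcancel

lemma radial_first_integrals (hx : x ∈ domain lam M Q p) (hequator : x 2 = Real.pi / 2)
    {v : Fin 4 → ℝ} (hv : v 2 = 0) (hnull : (metric lam M Q p x *ᵥ v) ⬝ᵥ v = 0) {E L : ℝ}
    (hE : -(metric lam M Q p x *ᵥ v) 0 = E) (hL : (metric lam M Q p x *ᵥ v) 3 = L) :
    v 3 * x 1 ^ 2 = L ∧ v 1 ^ 2 = E ^ 2 - horizonFn lam M Q (x 1) * (L ^ 2 / x 1 ^ 2) := by
  rw [metric_mulVec_dotProduct hequator hv] at hnull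
  simp only [metric_mulVec hequator hv, cons_val] at hE hL
  have hr := radius_ne_zero hx
  have hcentrifugal : L ^ 2 / x 1 ^ 2 = x 1 ^ 2 * v 3 ^ 2 := by
    rw [← hL]
    field_simp
  refine ⟨by rw [← hL, mul_comm], ?_⟩
  rw [hcentrifugal, ← hE]
  linear_combination horizonFn lam M Q (x 1) * hnull - v 1 ^ 2 * one_sub_sign_sq_div_mul hx

end Metric

section Motion

open Matrix

variable {lam M Q E L : ℝ} {I : Set ℝ} {r φ R : ℝ → ℝ} {l : ℝ}

/-- The radial and azimuthal equations of motion of an equatorial null curve with energy `E` and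
angular momentum `L`, at the parameter `l`. -/
structure RadialMotionAt (lam M Q E L : ℝ) (r φ : ℝ → ℝ) (l : ℝ) : Prop where
  radius_ne_zero : r l ≠ 0
  contDiffAt_radius : ContDiffAt ℝ 2 r l
  contDiffAt_azimuth : ContDiffAt ℝ 2 φ l
  azimuth : deriv φ l * r l ^ 2 = L
  energy : deriv r l ^ 2 = E ^ 2 - horizonFn lam M Q (r l) * (L ^ 2 / r l ^ 2)
  acceleration : deriv (deriv r) l = r l * horizonFn lam M Q (r l) * deriv φ l ^ 2
    - horizonFnDeriv lam M Q (r l) / 2 * (r l ^ 2 * deriv φ l ^ 2)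

lemma RadialMotionAt.deriv_azimuth_eq (h : RadialMotionAt lam M Q E L r φ l) :
    deriv φ l = L / r l ^ 2 := by
  rw [eq_div_iff (pow_ne_zero 2 h.radius_ne_zero), h.azimuth]

lemma RadialMotionAt.deriv_azimuth_ne_zero (h : RadialMotionAt lam M Q E L r φ l) (hL : L ≠ 0) :
    deriv φ l ≠ 0 :=
  fun hzero => hL (by rw [← h.azimuth, hzero, zero_mul])

lemma RadialMotionAt.hasDerivAt_radius (h : RadialMotionAt lam M Q E L r φ l) :
    HasDerivAt r (deriv r l) l :=
  (h.contDiffAt_radius.differentiableAt (by norm_num)).hasDerivAt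

lemma RadialMotionAt.hasDerivAt_deriv_radius (h : RadialMotionAt lam M Q E L r φ l) :
    HasDerivAt (deriv r) (deriv (deriv r) l) l :=
  ((h.contDiffAt_radius.derivWithin (m := 1) (by norm_num)).differentiableAt
    (by norm_num)).hasDerivAt

lemma IsEquatorialNullGeodesic.radialMotionAt (h : IsEquatorialNullGeodesic lam M Q E L I r φ)
    (hl : l ∈ I) : RadialMotionAt lam M Q E L r φ l := by
  obtain ⟨p, w, J, hJ, hlJ, -, hgeodesic, hconserved⟩ := h.exists_patch l hl
  set c : ℝ → Fin 4 → ℝ := fun l => ![w l, r l, Real.pi / 2, φ l]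
  set v : Fin 4 → ℝ := fun μ => velocity c μ l
  have hx := hgeodesic.mem l hlJ
  have hv : v 2 = 0 := deriv_const l (Real.pi / 2)
  have hnull : (metric lam M Q p (c l) *ᵥ v) ⬝ᵥ v = 0 := (hconserved l hlJ).1
  obtain ⟨hazimuth, henergy⟩ :=
    radial_first_integrals hx rfl hv hnull (hconserved l hlJ).2.1 (hconserved l hlJ).2.2
  have hradial := hgeodesic.geodesic_eq l hlJ 1
  rw [sum_christoffel_radial hx rfl hv, hnull] at hradial
  have hsmooth (μ : Fin 4) : ContDiffAt ℝ 2 (fun s => c s μ) l :=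
    contDiffAt_pi.1 (hgeodesic.contDiffOn.contDiffAt (hJ.mem_nhds hlJ)) μ
  refine ⟨RNdS.radius_ne_zero hx, hsmooth 1, hsmooth 3, hazimuth, henergy, ?_⟩
  change deriv (deriv r) l + (-horizonFnDeriv lam M Q (r l) / 2 * (0 - r l ^ 2 * deriv φ l ^ 2)
    - r l * horizonFn lam M Q (r l) * deriv φ l ^ 2) = 0 at hradial
  linear_combination hradial

lemma IsEquatorialNullGeodesic.isOpen_image (h : IsEquatorialNullGeodesic lam M Q E L I r φ)
    (hL : L ≠ 0) : IsOpen (φ '' I) := by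
  refine isOpen_iff_mem_nhds.2 ?_
  rintro _ ⟨l, hl, rfl⟩
  have hmotion := h.radialMotionAt hl
  have hφ := hmotion.contDiffAt_azimuth.hasStrictDerivAt (by norm_num)
  rw [← hφ.map_nhds_eq (hmotion.deriv_azimuth_ne_zero hL)]
  exact image_mem_map (h.isOpen.mem_nhds hl)

lemma IsEquatorialNullGeodesic.isPreconnected_image
    (h : IsEquatorialNullGeodesic lam M Q E L I r φ) : IsPreconnected (φ '' I) :=
  h.isPreconnected.image φ fun _ hl =>
    (h.radialMotionAt hl).contDiffAt_azimuth.continuousAt.continuousWithinAt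

lemma hasDerivAt_of_comp_eq (hI : I ∈ 𝓝 l) {f : ℝ → ℝ} {φ' f' : ℝ}
    (hφ : HasStrictDerivAt φ φ' l) (hφ' : φ' ≠ 0) (hf : HasDerivAt f f' l)
    (hR : ∀ m ∈ I, R (φ m) = f m) : HasDerivAt R (f' / φ') (φ l) := by
  set ψ := hφ.localInverse φ φ' l hφ'
  have hψ : HasDerivAt ψ φ'⁻¹ (φ l) := (hφ.to_localInverse hφ').hasDerivAt
  have hψl : ψ (φ l) = l := (hφ.hasStrictFDerivAt_equiv hφ').localInverse_apply_image
  have hright : ∀ᶠ x in 𝓝 (φ l), φ (ψ x) = x :=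
    (hφ.hasStrictFDerivAt_equiv hφ').eventually_right_inverse
  have hmem : ∀ᶠ x in 𝓝 (φ l), ψ x ∈ I := hψ.continuousAt.eventually (by rwa [hψl])
  have hcomp := HasDerivAt.comp (φ l) (h₂ := f) (by rwa [hψl]) hψ
  refine (hcomp.congr_of_eventuallyEq ?_).congr_deriv (div_eq_mul_inv _ _).symm
  filter_upwards [hright, hmem] with x hx hxI
  rw [Function.comp_apply, ← hR _ hxI, hx]

lemma IsEquatorialNullGeodesic.hasDerivAt_comp_azimuth
    (h : IsEquatorialNullGeodesic lam M Q E L I r φ) (hL : L ≠ 0) {f : ℝ → ℝ} {f' : ℝ}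
    (hR : ∀ m ∈ I, R (φ m) = f m) (hl : l ∈ I) (hf : HasDerivAt f f' l) :
    HasDerivAt R (f' * r l ^ 2 / L) (φ l) := by
  have hmotion := h.radialMotionAt hl
  refine (hasDerivAt_of_comp_eq (h.isOpen.mem_nhds hl)
    (hmotion.contDiffAt_azimuth.hasStrictDerivAt (by norm_num))
    (hmotion.deriv_azimuth_ne_zero hL) hf hR).congr_deriv ?_
  rw [hmotion.deriv_azimuth_eq, div_div_eq_mul_div]

lemma IsEquatorialNullGeodesic.hasDerivAt_polarRadius
    (h : IsEquatorialNullGeodesic lam M Q E L I r φ) (hL : L ≠ 0)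
    (hR : ∀ m ∈ I, R (φ m) = r m) (hl : l ∈ I) :
    HasDerivAt R (deriv r l * r l ^ 2 / L) (φ l) :=
  h.hasDerivAt_comp_azimuth hL hR hl (h.radialMotionAt hl).hasDerivAt_radius

/-- The quartic `f` of the orbit equation `(dr / dφ)² = f r` of null geodesics, with
`δ = λ + E² / L²`. -/
def orbitQuartic (δ M Q x : ℝ) : ℝ := δ * x ^ 4 - x ^ 2 + 2 * M * x - Q ^ 2

theorem IsEquatorialNullGeodesic.deriv_polarRadius_sq
    (h : IsEquatorialNullGeodesic lam M Q E L I r φ) (hL : L ≠ 0)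
    (hR : ∀ l ∈ I, R (φ l) = r l) {x : ℝ} (hx : x ∈ φ '' I) :
    deriv R x ^ 2 = orbitQuartic (lam + E ^ 2 / L ^ 2) M Q (R x) := by
  obtain ⟨l, hl, rfl⟩ := hx
  have hr := (h.radialMotionAt hl).radius_ne_zero
  rw [(h.hasDerivAt_polarRadius hL hR hl).deriv, hR l hl, div_pow, mul_pow,
    (h.radialMotionAt hl).energy, horizonFn, orbitQuartic]
  field_simp
  ring

theorem IsEquatorialNullGeodesic.hasDerivAt_deriv_polarRadius
    (h : IsEquatorialNullGeodesic lam M Q E L I r φ) (hL : L ≠ 0)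
    (hR : ∀ l ∈ I, R (φ l) = r l) {x : ℝ} (hx : x ∈ φ '' I) :
    HasDerivAt (deriv R) (2 * (lam + E ^ 2 / L ^ 2) * R x ^ 3 - R x + M) x := by
  obtain ⟨l, hl, rfl⟩ := hx
  have hmotion := h.radialMotionAt hl
  have hr := hmotion.radius_ne_zero
  have henergy := hmotion.energy
  have hvelocity := (hmotion.hasDerivAt_deriv_radius.mul
    (hmotion.hasDerivAt_radius.pow 2)).div_const L
  refine (h.hasDerivAt_comp_azimuth hL
    (fun m hm => (h.hasDerivAt_polarRadius hL hR hm).deriv) hl hvelocity).congr_deriv ?_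
  rw [hmotion.acceleration, hmotion.deriv_azimuth_eq, hR l hl, horizonFn, horizonFnDeriv]
  rw [horizonFn] at henergy
  simp only [Nat.cast_ofNat, Nat.add_one_sub_one, pow_one, Pi.pow_apply]
  field_simp
  field_simp at henergy
  linear_combination 2 * henergy

end Motion

end RNdS

section BiermannWeierstrass

/-- The invariant `g₂` of the quartic `α y + β y² + γ y³ + δ y⁴`. -/
def quarticG₂ {K : Type*} [Field K] (α β γ : K) : K :=
  1 / 4 * (β ^ 2 / 3 - α * γ)

/-- The invariant `g₃` of the quartic `α y + β y² + γ y³ + δ y⁴`. -/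
def quarticG₃ {K : Type*} [Field K] (α β γ δ : K) : K :=
  1 / 8 * (α * β * γ / 6 - α ^ 2 * δ / 2 - β ^ 3 / 27)

lemma ne_zero_of_quarticG₂_quarticG₃_disc_ne_zero {K : Type*} [Field K] [CharZero K]
    {α β γ δ : K} (hdisc : quarticG₂ α β γ ^ 3 - 27 * quarticG₃ α β γ δ ^ 2 ≠ 0) : α ≠ 0 := by
  rintro rfl
  refine hdisc ?_
  rw [quarticG₂, quarticG₃]
  ring

lemma mul_invQuarticHalfDeriv_quarticG₂_quarticG₃ {K : Type*} [Field K] [CharZero K]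
    (α β γ δ u : K) :
    α / 4 * invQuarticHalfDeriv (β / 12) (quarticG₂ α β γ) (quarticG₃ α β γ δ) u =
      α / 2 + β * (α / 4 * u) + 3 / 2 * γ * (α / 4 * u) ^ 2 + 2 * δ * (α / 4 * u) ^ 3 := by
  rw [invQuarticHalfDeriv, quarticG₂, quarticG₃]
  ring

lemma cubic_quarticG₂_quarticG₃ {K : Type*} [Field K] [CharZero K] (α β γ δ : K) {y : K}
    (hy : y ≠ 0) :
    4 * (α / (4 * y) + β / 12) ^ 3 - quarticG₂ α β γ * (α / (4 * y) + β / 12)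
        - quarticG₃ α β γ δ =
      (α / (4 * y ^ 2)) ^ 2 * (α * y + β * y ^ 2 + γ * y ^ 3 + δ * y ^ 4) := by
  rw [quarticG₂, quarticG₃]
  field_simp
  ring

variable {Λ : PeriodPair} {α β γ δ z₀ : ℂ}

lemma eq_div_weierstrassP_of_invWeierstrassP_eq {y z : ℂ} (hα : α ≠ 0)
    (hdom : z ∈ invWeierstrassPDomain Λ (β / 12))
    (hy : invWeierstrassP Λ (β / 12) z = y / (α / 4)) :
    (z ∉ Λ.lattice → 4 * Λ.weierstrassP z - β / 3 ≠ 0 ∧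
      y = α / (4 * Λ.weierstrassP z - β / 3)) ∧ (z ∈ Λ.lattice → y = 0) := by
  have hy' : y = α / 4 * invWeierstrassP Λ (β / 12) z := by
    rw [hy]
    field_simp
  have hfour : 4 * Λ.weierstrassP z - β / 3 = 4 * (Λ.weierstrassP z - β / 12) := by ring
  refine ⟨fun hl => ⟨?_, ?_⟩, fun hl => ?_⟩
  · rw [hfour]
    exact mul_ne_zero (by norm_num) (sub_ne_zero.2 (hdom.resolve_left hl))
  · rw [hy', invWeierstrassP_of_notMem hl, hfour, div_mul_div_comm, mul_one]
  · rw [hy', invWeierstrassP_of_mem hl, mul_zero]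

theorem eq_div_weierstrassP_of_solvesSecondOrder (hα : α ≠ 0) (hΛ₂ : Λ.g₂ = quarticG₂ α β γ)
    (hΛ₃ : Λ.g₃ = quarticG₃ α β γ δ) {J : Set ℝ} (hJo : IsOpen J) (hJc : IsPreconnected J)
    {y y' : ℝ → ℂ} (hy : ∀ x ∈ J, SolvesSecondOrderAt
      (fun y => α / 2 + β * y + 3 / 2 * γ * y ^ 2 + 2 * δ * y ^ 3) y y' x)
    {x₀ : ℝ} (hx₀ : x₀ ∈ J) (hy₀ : y x₀ ≠ 0) (hl : z₀ + x₀ ∉ Λ.lattice)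
    (hP : Λ.weierstrassP (z₀ + x₀) = α / (4 * y x₀) + β / 12)
    (hP' : Λ.derivWeierstrassP (z₀ + x₀) = -(α / (4 * y x₀ ^ 2) * y' x₀))
    {x : ℝ} (hx : x ∈ J) :
    (z₀ + x ∉ Λ.lattice → 4 * Λ.weierstrassP (z₀ + x) - β / 3 ≠ 0 ∧
      y x = α / (4 * Λ.weierstrassP (z₀ + x) - β / 3)) ∧ (z₀ + x ∈ Λ.lattice → y x = 0) := by
  have hdiff : Λ.weierstrassP (z₀ + x₀) - β / 12 = α / (4 * y x₀) := by
    rw [hP, add_sub_cancel_right]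
  have hc : Λ.weierstrassP (z₀ + x₀) ≠ β / 12 :=
    sub_ne_zero.1 (hdiff ▸ div_ne_zero hα (mul_ne_zero (by norm_num) hy₀))
  have hu (t : ℝ) (ht : t ∈ J) : SolvesSecondOrderAt (invQuarticHalfDeriv (β / 12) Λ.g₂ Λ.g₃)
      (fun s => y s / (α / 4)) (fun s => y' s / (α / 4)) t := by
    have hα₄ : α / 4 ≠ 0 := div_ne_zero hα (by norm_num)
    refine ⟨(hy t ht).hasDerivAt.div_const _,
      ((hy t ht).hasDerivAt_velocity.div_const _).congr_deriv ?_⟩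
    rw [div_eq_iff hα₄, hΛ₂, hΛ₃, mul_comm _ (α / 4),
      mul_invQuarticHalfDeriv_quarticG₂_quarticG₃, mul_div_cancel₀ _ hα₄]
  have hvalue : invWeierstrassP Λ (β / 12) (z₀ + x₀) = y x₀ / (α / 4) := by
    rw [invWeierstrassP_of_notMem hl, hdiff]
    field_simp
  have hderiv : deriv (invWeierstrassP Λ (β / 12)) (z₀ + x₀) = y' x₀ / (α / 4) := by
    rw [deriv_invWeierstrassP_of_notMem hl hc, hdiff, hP']
    field_simp
  obtain ⟨hdom, heq⟩ :=
    eq_invWeierstrassP_of_solvesSecondOrder hJo hJc hu hx₀ (Or.inr hc) hvalue hderiv hx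
  exact eq_div_weierstrassP_of_invWeierstrassP_eq hα hdom heq

end BiermannWeierstrass

namespace RNdS

section PolarOrbit

variable {lam M Q E L rbar α β γ δ : ℝ} {I : Set ℝ} {r φ R : ℝ → ℝ} {x : ℝ}

lemma orbitQuartic_add (hrbar : orbitQuartic δ M Q rbar = 0) (hγ : γ = 4 * rbar * δ)
    (hβ : β = 6 * rbar ^ 2 * δ - 1) (hα : α = 4 * rbar ^ 3 * δ - 2 * rbar + 2 * M) (y : ℝ) :
    orbitQuartic δ M Q (rbar + y) = α * y + β * y ^ 2 + γ * y ^ 3 + δ * y ^ 4 := by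
  rw [orbitQuartic] at hrbar ⊢
  rw [hα, hβ, hγ]
  linear_combination hrbar

theorem IsEquatorialNullGeodesic.solvesSecondOrderAt
    (h : IsEquatorialNullGeodesic lam M Q E L I r φ) (hL : L ≠ 0) (hR : ∀ l ∈ I, R (φ l) = r l)
    (hδ : δ = lam + E ^ 2 / L ^ 2) (hγ : γ = 4 * rbar * δ) (hβ : β = 6 * rbar ^ 2 * δ - 1)
    (hα : α = 4 * rbar ^ 3 * δ - 2 * rbar + 2 * M) (hx : x ∈ φ '' I) :
    SolvesSecondOrderAt (fun y : ℂ => α / 2 + β * y + 3 / 2 * γ * y ^ 2 + 2 * δ * y ^ 3)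
      (fun t => (R t : ℂ) - rbar) (fun t => ((deriv R t : ℝ) : ℂ)) x := by
  have hvelocity : HasDerivAt R (deriv R x) x := by
    obtain ⟨l, hl, rfl⟩ := hx
    exact (h.hasDerivAt_polarRadius hL hR hl).differentiableAt.hasDerivAt
  refine ⟨hvelocity.ofReal_comp.sub_const _,
    (h.hasDerivAt_deriv_polarRadius hL hR hx).ofReal_comp.congr_deriv ?_⟩
  rw [← hδ, hα, hβ, hγ]
  push_cast
  ring

lemma IsEquatorialNullGeodesic.weierstrass_cubic_eq_sq
    (h : IsEquatorialNullGeodesic lam M Q E L I r φ) (hL : L ≠ 0) (hR : ∀ l ∈ I, R (φ l) = r l)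
    (hrbar : orbitQuartic δ M Q rbar = 0)
    (hδ : δ = lam + E ^ 2 / L ^ 2) (hγ : γ = 4 * rbar * δ) (hβ : β = 6 * rbar ^ 2 * δ - 1)
    (hα : α = 4 * rbar ^ 3 * δ - 2 * rbar + 2 * M) (hx : x ∈ φ '' I) (hne : R x ≠ rbar)
    {w : ℝ} (hw : w = α / (4 * (R x - rbar)) + β / 12) :
    4 * w ^ 3 - quarticG₂ α β γ * w - quarticG₃ α β γ δ =
      (α / (4 * (R x - rbar) ^ 2) * deriv R x) ^ 2 := by
  rw [hw, cubic_quarticG₂_quarticG₃ α β γ δ (sub_ne_zero.2 hne),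
    ← orbitQuartic_add hrbar hγ hβ hα, add_sub_cancel, hδ, ← h.deriv_polarRadius_sq hL hR hx,
    mul_pow]

end PolarOrbit

end RNdS

theorem corollary4p2_general
    (lam M Q : ℝ)
    (L E r₀ rdot₀ : ℝ) (hL : L ≠ 0)
    (I : Set ℝ) (r φ : ℝ → ℝ)
    (hgeo : RNdS.IsEquatorialNullGeodesic lam M Q E L I r φ)
    (R : ℝ → ℝ) (hR : ∀ l ∈ I, R (φ l) = r l)
    (h0 : (0 : ℝ) ∈ φ '' I) (hR₀ : R 0 = r₀) (hRdot₀ : HasDerivAt R rdot₀ 0)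
    (rbar α β γ δ g₂ g₃ : ℝ)
    (hrbar : (lam + E ^ 2 / L ^ 2) * rbar ^ 4 - rbar ^ 2 + 2 * M * rbar - Q ^ 2 = 0)
    (hδ : δ = lam + E ^ 2 / L ^ 2)
    (hγ : γ = 4 * rbar * δ)
    (hβ : β = 6 * rbar ^ 2 * δ - 1)
    (hα : α = 4 * rbar ^ 3 * δ - 2 * rbar + 2 * M)
    (hg₂ : g₂ = 1 / 4 * (β ^ 2 / 3 - α * γ))
    (hg₃ : g₃ = 1 / 8 * (α * β * γ / 6 - α ^ 2 * δ / 2 - β ^ 3 / 27))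
    (hdisc : g₂ ^ 3 - 27 * g₃ ^ 2 ≠ 0)
    (Λ : PeriodPair) (hΛ₂ : Λ.g₂ = g₂) (hΛ₃ : Λ.g₃ = g₃)
    (z₁ z₂ z₃ : ℂ)
    (hz : ∀ s : ℂ, 4 * s ^ 3 - g₂ * s - g₃ = 4 * ((s - z₁) * (s - z₂) * (s - z₃)))
    (hne : r₀ ≠ rbar)
    (wp₀ : ℝ) (hwp₀ : wp₀ = α / (4 * (r₀ - rbar)) + β / 12)
    (z₀ : ℂ)
    (hz₀ : z₀ = (if 0 ≤ α * rdot₀ then 1 else -1) *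
      RNdS.carlsonRF (wp₀ - z₁) (wp₀ - z₂) (wp₀ - z₃)) :
    IntegrableOn (RNdS.carlsonIntegrand (wp₀ - z₁) (wp₀ - z₂) (wp₀ - z₃)) (Ioi 0) ∧
    ∀ x ∈ φ '' I,
      (z₀ + x ∉ Λ.lattice →
        4 * Λ.weierstrassP (z₀ + x) - β / 3 ≠ 0 ∧
        (R x : ℂ) = rbar + α / (4 * Λ.weierstrassP (z₀ + x) - β / 3)) ∧
      (z₀ + x ∈ Λ.lattice → R x = rbar) := by
  have hα₀ : α ≠ 0 := by
    rw [hg₂, hg₃] at hdisc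
    exact ne_zero_of_quarticG₂_quarticG₃_disc_ne_zero hdisc
  have hy₀ := sub_ne_zero.2 hne
  set q := α / (4 * (r₀ - rbar) ^ 2) * rdot₀ with hq
  have hcubic : 4 * wp₀ ^ 3 - g₂ * wp₀ - g₃ = q ^ 2 := by
    subst hR₀
    rw [hq, ← hRdot₀.deriv, hg₂, hg₃]
    exact hgeo.weierstrass_cubic_eq_sq hL hR (hδ ▸ hrbar) hδ hγ hβ hα h0 hne hwp₀
  have hsign : 0 ≤ q ↔ 0 ≤ α * rdot₀ := by
    rw [hq, div_mul_eq_mul_div, le_div_iff₀ (by positivity), zero_mul]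
  obtain ⟨hl, hP, hP'⟩ := weierstrassP_signed_carlsonRF hΛ₂ hΛ₃ hdisc hz hcubic
    (by simpa only [hsign] using hz₀)
  refine ⟨integrableOn_carlsonIntegrand hdisc hz, fun x hx => ?_⟩
  have hy := eq_div_weierstrassP_of_solvesSecondOrder (Λ := Λ) (z₀ := z₀)
    (Complex.ofReal_ne_zero.2 hα₀)
    (by simp [hΛ₂, hg₂, quarticG₂]) (by simp [hΛ₃, hg₃, quarticG₃])
    (hgeo.isOpen_image hL) hgeo.isPreconnected_image
    (fun t ht => hgeo.solvesSecondOrderAt hL hR hδ hγ hβ hα ht) h0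
    (by rw [hR₀]; exact_mod_cast hy₀) (by simpa using hl) (by simp [hP, hwp₀, hR₀])
    (by simp [hP', hq, hR₀, hRdot₀.deriv]) hx
  simpa only [sub_eq_iff_eq_add', add_zero, Complex.ofReal_inj] using hy

theorem corollary4p2
    -- the spacetime
    (lam M Q : ℝ) (hM : 0 ≤ M) (hQ : 0 ≤ Q)
    -- the data of the orbit
    (L E r₀ rdot₀ : ℝ) (hL : L ≠ 0) (hE : 0 < E) (hr₀ : 0 < r₀)
    (hLE : 0 ≤ lam * L ^ 2 + E ^ 2)
    -- the geodesic, its polar radius `R`, and the polar initial condition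
    (I : Set ℝ) (r φ : ℝ → ℝ)
    (hgeo : RNdS.IsEquatorialNullGeodesic lam M Q E L I r φ)
    (R : ℝ → ℝ) (hR : ∀ l ∈ I, R (φ l) = r l)
    (h0 : (0 : ℝ) ∈ φ '' I) (hR₀ : R 0 = r₀) (hRdot₀ : HasDerivAt R rdot₀ 0)
    -- the constants
    (rbar α β γ δ g₂ g₃ : ℝ)
    (hrbar : (lam + E ^ 2 / L ^ 2) * rbar ^ 4 - rbar ^ 2 + 2 * M * rbar - Q ^ 2 = 0)
    (hδ : δ = lam + E ^ 2 / L ^ 2)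
    (hγ : γ = 4 * rbar * δ)
    (hβ : β = 6 * rbar ^ 2 * δ - 1)
    (hα : α = 4 * rbar ^ 3 * δ - 2 * rbar + 2 * M)
    (hg₂ : g₂ = 1 / 4 * (β ^ 2 / 3 - α * γ))
    (hg₃ : g₃ = 1 / 8 * (α * β * γ / 6 - α ^ 2 * δ / 2 - β ^ 3 / 27))
    (hdisc : g₂ ^ 3 - 27 * g₃ ^ 2 ≠ 0)
    -- the period lattice with invariants `g₂`, `g₃`
    (Λ : PeriodPair) (hΛ₂ : Λ.g₂ = g₂) (hΛ₃ : Λ.g₃ = g₃)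
    -- the roots of the Weierstrass cubic
    (z₁ z₂ z₃ : ℂ)
    (hz : ∀ s : ℂ, 4 * s ^ 3 - g₂ * s - g₃ = 4 * ((s - z₁) * (s - z₂) * (s - z₃)))
    -- the initial value of `℘` and the initial argument
    (hne : r₀ ≠ rbar)
    (wp₀ : ℝ) (hwp₀ : wp₀ = α / (4 * (r₀ - rbar)) + β / 12)
    (z₀ : ℂ)
    (hz₀ : z₀ = (if 0 ≤ α * rdot₀ then 1 else -1) *
      RNdS.carlsonRF (wp₀ - z₁) (wp₀ - z₂) (wp₀ - z₃)) :
    -- the integral defining `z₀` converges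
    IntegrableOn (RNdS.carlsonIntegrand (wp₀ - z₁) (wp₀ - z₂) (wp₀ - z₃)) (Ioi 0) ∧
    -- the formula, read as `R x = rbar` where `℘` has a pole
    ∀ x ∈ φ '' I,
      (z₀ + x ∉ Λ.lattice →
        4 * Λ.weierstrassP (z₀ + x) - β / 3 ≠ 0 ∧
        (R x : ℂ) = rbar + α / (4 * Λ.weierstrassP (z₀ + x) - β / 3)) ∧
      (z₀ + x ∈ Λ.lattice → R x = rbar) :=
  corollary4p2_general lam M Q L E r₀ rdot₀ hL I r φ hgeo R hR h0 hR₀ hRdot₀ rbar α β γ δ g₂ g₃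
    hrbar hδ hγ hβ hα hg₂ hg₃ hdisc Λ hΛ₂ hΛ₃ z₁ z₂ z₃ hz hne wp₀ hwp₀ z₀ hz₀
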